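/- Let $K$ be a field and let $Q$ be a finite connected (nonempty) quiver with $n$ vertices; let $J$ be the ideal of the path algebra $KQ$ generated by the arrows, and let $A$ be a $K$-algebra isomorphic to $KQ/J^2$. Modules are finitely generated right modules; $\Omega$ and $\Omega^{-1}$ denote the syzygy and cosyzygy taken with respect to projective covers and injective envelopes. Put $A_0=KQ/J$, and assume that $Q$ has no member, i.e. every vertex of $Q$ lies in the support of $\Omega^{n}(A_0)$ and in the support of $\Omega^{-n}(A_0)$ (modules over $KQ/J^2$; the support of $M$ is the set of vertices whose simple module is a composition factor of $M$). Let $K_0$ be the abelian group generated by the symbols $[M]$, one for each isomorphism class of modules, with relations $[M]=[M']+[M'']$ if $M\cong M'\oplus M''$ and $[P]=0$ for $P$ projective; let $\overline\Omega:K_0\to K_0$ be the endomorphism $[M]\mapsto[\Omega M]$, and let $\langle \mathrm{add}\, M\rangle\subseteq K_0$ be the subgroup generated by the classes of the indecomposable direct summands of $M$. Let $\phi(M)$ be the least $l$ such that $\overline\Omega$ is injective on $\overline\Omega^{\,l+s}\langle \mathrm{add}\, M\rangle$ for all $s\ge 0$, and let $\phi\dim(A)=\sup_M \phi(M)$. Let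 $\mathfrak M_Q$ be the adjacency matrix of $Q$, considered over $\mathbb C$; its $(i,j)$ entry is the number of arrows from $i$ to $j$. Let $m_a$ and $m_g$ be the algebraic and geometric multiplicities of $0$ for $\mathfrak M_Q$ (both are $0$ if $0$ is not an eigenvalue). Let $Z_k$ ($k\ge1$) be the oriented cycle with $k$ vertices and $k$ arrows. Then: 1. $\phi\dim(A)\le 2$ if and only if $m_a=m_g$. 2. $\phi\dim(A)=0$ if and only if $Q$ is $Z_k$ for some $k \ge 1$, if and only if $A$ is selfinjective; in this case $0$ is not an eigenvalue of $\mathfrak M_Q$. 3. $\phi\dim(A)=1$ if and only if $A$ is not selfinjective and $0$ is not an eigenvalue of $\mathfrak M_Q$. 4. If $m_a=m_g$, then $\phi\dim(A)=2$ if and only if $0$ is an eigenvalue of $\mathfrak M_Q$. -/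

import Mathlib

open CategoryTheory

universe u v w uK

/-! # Projective covers, injective envelopes, syzygies and cosyzygies -/

section Syzygies

variable {R : Type u} [Ring R]

/-- `p : P → M` is a projective cover: `P` is projective, `p` is onto and `ker p` is
superfluous. -/
structure IsProjectiveCover {P M : Type u} [AddCommGroup P] [Module R P]
    [AddCommGroup M] [Module R M] (p : P →ₗ[R] M) : Prop where
  projective : Module.Projective R P
  surjective : Function.Surjective p
  superfluous : ∀ L : Submodule R P, L ⊔ LinearMap.ker p = ⊤ → L = ⊤

/-- `i : M → I` is an injective envelope: `I` is injective, `i` is one-to-one and the image of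
`i` is essential in `I`. -/
structure IsInjectiveEnvelope {M I : Type u} [AddCommGroup M] [Module R M]
    [AddCommGroup I] [Module R I] (i : M →ₗ[R] I) : Prop where
  injective_module : Module.Injective R I
  injective : Function.Injective i
  essential : ∀ L : Submodule R I, L ⊓ LinearMap.range i = ⊥ → L = ⊥

/-- `N` is (isomorphic to) the syzygy `Ω M`: the kernel of a projective cover of `M`. -/
def IsSyzygy (M N : FGModuleCat.{u} R) : Prop :=
  ∃ (P : FGModuleCat.{u} R) (p : P →ₗ[R] M),
    IsProjectiveCover p ∧ Nonempty (N ≃ₗ[R] LinearMap.ker p)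

/-- `N` is (isomorphic to) the cosyzygy `Ω⁻¹ M`: the cokernel of an injective envelope
of `M`. -/
def IsCosyzygy (M N : FGModuleCat.{u} R) : Prop :=
  ∃ (I : FGModuleCat.{u} R) (i : M →ₗ[R] I),
    IsInjectiveEnvelope i ∧ Nonempty (N ≃ₗ[R] (I ⧸ LinearMap.range i))

/-- `N` is (isomorphic to) the `k`-th syzygy `Ω^k M`. -/
def IsIterSyzygy : ℕ → FGModuleCat.{u} R → FGModuleCat.{u} R → Prop
  | 0, M, N => Nonempty (M ≃ₗ[R] N)
  | k + 1, M, N => ∃ L : FGModuleCat.{u} R, IsSyzygy M L ∧ IsIterSyzygy k L N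

/-- `N` is (isomorphic to) the `k`-th cosyzygy `Ω^{-k} M`. -/
def IsIterCosyzygy : ℕ → FGModuleCat.{u} R → FGModuleCat.{u} R → Prop
  | 0, M, N => Nonempty (M ≃ₗ[R] N)
  | k + 1, M, N => ∃ L : FGModuleCat.{u} R, IsCosyzygy M L ∧ IsIterCosyzygy k L N

/-- Over an artinian ring every finitely generated module has a projective cover. -/
theorem exists_isProjectiveCover [IsArtinianRing R] (M : FGModuleCat.{u} R) :
    ∃ (P : FGModuleCat.{u} R) (p : P →ₗ[R] M), IsProjectiveCover p := by
  obtain ⟨n, p, hp⟩ := Module.Finite.exists_fin' R M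
  let C : Set (Submodule R (Fin n → R)) :=
    {X | Module.Projective R X ∧ X.map p = ⊤}
  have hC : C.Nonempty := by
    refine ⟨⊤, Module.Projective.of_equiv (Submodule.topEquiv (R := R)).symm, ?_⟩
    rw [Submodule.map_top, LinearMap.range_eq_top.2 hp]
  obtain ⟨X, ⟨hXp, hXs⟩, hXm⟩ := WellFounded.has_min
    (wellFounded_lt : WellFounded ((· < ·) : Submodule R (Fin n → R) → _ → Prop)) C hC
  have hq : Function.Surjective (p.domRestrict X) := by
    intro m
    have : m ∈ X.map p := hXs ▸ Submodule.mem_top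
    obtain ⟨x, hx, rfl⟩ := this
    exact ⟨⟨x, hx⟩, rfl⟩
  refine ⟨FGModuleCat.of R X, p.domRestrict X, hXp, hq, fun L hL => ?_⟩
  have hL' : Function.Surjective ((p.domRestrict X).domRestrict L) := by
    intro m
    obtain ⟨x, rfl⟩ := hq m
    have hx : x ∈ L ⊔ LinearMap.ker (p.domRestrict X) := by rw [hL]; trivial
    obtain ⟨l, hl, k, hk, rfl⟩ := Submodule.mem_sup.1 hx
    refine ⟨⟨l, hl⟩, ?_⟩
    rw [map_add, LinearMap.mem_ker.1 hk, add_zero]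
    rfl
  obtain ⟨h, hh⟩ := Module.projective_lifting_property
    ((p.domRestrict X).domRestrict L) (p.domRestrict X) hL'
  let g : Module.End R X := L.subtype ∘ₗ h
  have hg : ∀ x, p.domRestrict X (g x) = p.domRestrict X x := fun x =>
    LinearMap.congr_fun hh x
  have hgk : ∀ (k : ℕ) (x : X), p.domRestrict X ((g ^ k) x) = p.domRestrict X x := by
    intro k
    induction k with
    | zero => intro x; rfl
    | succ k ih => intro x; rw [pow_succ', Module.End.mul_apply, hg, ih]
  obtain ⟨k, hk1, hk⟩ := ((Filter.eventually_ge_atTop 1).and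
    g.eventually_isCompl_ker_pow_range_pow).exists
  set Y := LinearMap.range (g ^ k) with hY
  have hYp : Module.Projective R Y :=
    Module.Projective.of_split Y.subtype (Y.projectionOnto _ hk.symm)
      (LinearMap.ext fun y => Submodule.projectionOnto_apply_left hk.symm y)
  have hYC : Y.map X.subtype ∈ C := by
    refine ⟨Module.Projective.of_equiv
      (Submodule.equivMapOfInjective X.subtype X.injective_subtype Y), ?_⟩
    rw [eq_top_iff]
    intro m _
    obtain ⟨x, rfl⟩ := hq m
    exact ⟨((g ^ k) x : X), ⟨(g ^ k) x, ⟨x, rfl⟩, rfl⟩, hgk k x⟩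
  have hle : Y.map X.subtype ≤ X := Submodule.map_subtype_le X Y
  have heq : Y.map X.subtype = X := by
    by_contra hne
    exact hXm _ hYC (lt_of_le_of_ne hle hne)
  have hYt : Y = ⊤ := by
    rw [eq_top_iff]
    intro x _
    have hx : (x : Fin n → R) ∈ Y.map X.subtype := heq.symm ▸ x.2
    obtain ⟨y, hy, hyx⟩ := hx
    rwa [← Subtype.ext hyx]
  rw [eq_top_iff, ← hYt]
  rintro _ ⟨x, rfl⟩
  obtain ⟨j, rfl⟩ : ∃ j, k = j + 1 := ⟨k - 1, by omega⟩
  rw [pow_succ', Module.End.mul_apply]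
  exact (h ((g ^ j) x)).2

theorem exists_isSyzygy [IsArtinianRing R] (M : FGModuleCat.{u} R) :
    ∃ N : FGModuleCat.{u} R, IsSyzygy M N := by
  obtain ⟨P, p, hp⟩ := exists_isProjectiveCover M
  exact ⟨FGModuleCat.of R (LinearMap.ker p), P, p, hp, ⟨LinearEquiv.refl R _⟩⟩

/-- The syzygy `Ω M` of a finitely generated module over an artinian ring (well defined up to
isomorphism). -/
noncomputable def Omega [IsArtinianRing R] (M : FGModuleCat.{u} R) : FGModuleCat.{u} R :=
  (exists_isSyzygy M).choose

theorem isSyzygy_Omega [IsArtinianRing R] (M : FGModuleCat.{u} R) : IsSyzygy M (Omega M) :=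
  (exists_isSyzygy M).choose_spec

end Syzygies

/-! # The group `K₀` and the Igusa-Todorov function -/

section IgusaTodorov

variable (R : Type u) [Ring R]

/-- The relations of `K₀`: `[M] - [M'] - [M'']` whenever `M ≅ M' ⊕ M''`, and `[P]` for `P`
projective. Since `0` is projective, the first relation with `M'' = 0` identifies the symbols of
isomorphic modules. -/
def K0Relations : AddSubgroup (FreeAbelianGroup (FGModuleCat.{u} R)) :=
  AddSubgroup.closure
    ({x | ∃ M M' M'' : FGModuleCat.{u} R, Nonempty (M ≃ₗ[R] M' × M'') ∧
        x = FreeAbelianGroup.of M - FreeAbelianGroup.of M' - FreeAbelianGroup.of M''} ∪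
      {x | ∃ P : FGModuleCat.{u} R, Module.Projective R P ∧ x = FreeAbelianGroup.of P})

/-- The group `K₀` of finitely generated `R`-modules modulo direct sums and projectives. -/
abbrev K0 : Type (u + 1) := FreeAbelianGroup (FGModuleCat.{u} R) ⧸ K0Relations R

variable {R}

/-- The class `[M]` in `K₀`. -/
def K0.cls (M : FGModuleCat.{u} R) : K0 R :=
  QuotientAddGroup.mk (FreeAbelianGroup.of M)

theorem K0.cls_of_equiv_prod {M M' M'' : FGModuleCat.{u} R} (e : M ≃ₗ[R] M' × M'') :
    K0.cls M = K0.cls M' + K0.cls M'' := by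
  have h : (QuotientAddGroup.mk (FreeAbelianGroup.of M - FreeAbelianGroup.of M' -
      FreeAbelianGroup.of M'') : K0 R) = 0 :=
    (QuotientAddGroup.eq_zero_iff _).2
      (AddSubgroup.subset_closure (Or.inl ⟨M, M', M'', ⟨e⟩, rfl⟩))
  rw [QuotientAddGroup.mk_sub, QuotientAddGroup.mk_sub, sub_sub, sub_eq_zero] at h
  exact h

theorem K0.cls_projective (P : FGModuleCat.{u} R) [Module.Projective R P] : K0.cls P = 0 :=
  (QuotientAddGroup.eq_zero_iff _).2 (AddSubgroup.subset_closure (Or.inr ⟨P, ‹_›, rfl⟩))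

/-- Schanuel's lemma, in `K₀`: the class of the kernel of an epimorphism `P → M` with `P`
projective depends only on `M`. -/
theorem K0.cls_kernel_eq {M M' P P' N N' : FGModuleCat.{u} R}
    [Module.Projective R P] [Module.Projective R P']
    (p : P →ₗ[R] M) (p' : P' →ₗ[R] M') (hp : Function.Surjective p)
    (hp' : Function.Surjective p') (e : M ≃ₗ[R] M')
    (f : N ≃ₗ[R] LinearMap.ker p) (f' : N' ≃ₗ[R] LinearMap.ker p') :
    K0.cls N = K0.cls N' := by
  obtain ⟨σ, hσ⟩ := Module.projective_lifting_property p' (e.toLinearMap ∘ₗ p) hp'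
  obtain ⟨τ, hτ⟩ := Module.projective_lifting_property p (e.symm.toLinearMap ∘ₗ p') hp
  have hσ' : ∀ x, p' (σ x) = e (p x) := fun x => LinearMap.congr_fun hσ x
  have hτ' : ∀ y, p (τ y) = e.symm (p' y) := fun y => LinearMap.congr_fun hτ y
  let E : (LinearMap.ker p × P') ≃ₗ[R] (P × LinearMap.ker p') :=
    { toFun := fun z => (z.1 + τ z.2, ⟨z.2 - σ (z.1 + τ z.2), by
        simp [hσ', hτ']⟩)
      map_add' := fun a b => by
        ext <;> simp <;> abel
      map_smul' := fun r a => by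
        ext <;> simp [smul_sub]
      invFun := fun z => (⟨z.1 - τ (z.2 + σ z.1), by
        simp [hσ', hτ']⟩, z.2 + σ z.1)
      left_inv := fun z => by
        ext <;> simp
      right_inv := fun z => by
        ext <;> simp }
  have h1 : K0.cls (FGModuleCat.of R (N × P')) = K0.cls N + K0.cls P' :=
    K0.cls_of_equiv_prod (LinearEquiv.refl R _)
  have h2 : K0.cls (FGModuleCat.of R (N × P')) = K0.cls P + K0.cls N' :=
    K0.cls_of_equiv_prod
      ((f.prodCongr (LinearEquiv.refl R P')).trans
        (E.trans ((LinearEquiv.refl R P).prodCongr f'.symm)))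
  rw [K0.cls_projective P', add_zero] at h1
  rw [K0.cls_projective P, zero_add] at h2
  exact h1.symm.trans h2

variable [IsArtinianRing R]

theorem K0.cls_Omega_prod {M M' M'' : FGModuleCat.{u} R} (e : M ≃ₗ[R] M' × M'') :
    K0.cls (Omega M) = K0.cls (Omega M') + K0.cls (Omega M'') := by
  obtain ⟨P, p, hp, ⟨f⟩⟩ := isSyzygy_Omega M
  obtain ⟨P', p', hp', ⟨f'⟩⟩ := isSyzygy_Omega M'
  obtain ⟨P'', p'', hp'', ⟨f''⟩⟩ := isSyzygy_Omega M''
  have := hp.projective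
  have := hp'.projective
  have := hp''.projective
  let g : (Omega M' × Omega M'') ≃ₗ[R] LinearMap.ker (p'.prodMap p'') :=
    (f'.prodCongr f'').trans
      { toFun := fun z => ⟨(z.1, z.2), by simp⟩
        map_add' := fun _ _ => rfl
        map_smul' := fun _ _ => rfl
        invFun := fun z => (⟨z.1.1, (Prod.ext_iff.1 z.2).1⟩, ⟨z.1.2, (Prod.ext_iff.1 z.2).2⟩)
        left_inv := fun _ => rfl
        right_inv := fun _ => rfl }
  have h1 : K0.cls (Omega M) = K0.cls (FGModuleCat.of R (Omega M' × Omega M'')) :=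
    K0.cls_kernel_eq (M' := FGModuleCat.of R (M' × M''))
      (P' := FGModuleCat.of R (P' × P'')) p (p'.prodMap p'') hp.surjective
      (hp'.surjective.prodMap hp''.surjective) e f g
  rw [h1]
  exact K0.cls_of_equiv_prod (LinearEquiv.refl R _)

theorem K0.cls_Omega_projective (P : FGModuleCat.{u} R) [Module.Projective R P] :
    K0.cls (Omega P) = 0 := by
  obtain ⟨Q, q, hq, ⟨f⟩⟩ := isSyzygy_Omega P
  have := hq.projective
  let Z : FGModuleCat.{u} R :=
    FGModuleCat.of R (LinearMap.ker (LinearMap.id : P →ₗ[R] P))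
  have hs : Subsingleton Z :=
    ⟨fun a b => Subtype.ext ((LinearMap.mem_ker.1 a.2).trans (LinearMap.mem_ker.1 b.2).symm)⟩
  have : Module.Projective R Z := Module.Projective.of_free
  rw [K0.cls_kernel_eq (N' := Z) q LinearMap.id hq.surjective Function.surjective_id
    (LinearEquiv.refl R P) f (LinearEquiv.refl R _), K0.cls_projective Z]

/-- The endomorphism `Ω̄` of `K₀` induced by `Ω`, that is `Ω̄ [M] = [Ω M]`. -/
noncomputable def OmegaBar : K0 R →+ K0 R :=
  QuotientAddGroup.lift (K0Relations R)
    (FreeAbelianGroup.lift fun M => K0.cls (Omega M)) (by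
      have h : K0Relations R ≤
          (FreeAbelianGroup.lift fun M : FGModuleCat.{u} R => K0.cls (Omega M)).ker := by
        refine (AddSubgroup.closure_le _).2 ?_
        rintro x (⟨M, M', M'', ⟨e⟩, rfl⟩ | ⟨P, hP, rfl⟩)
        · simp [AddMonoidHom.mem_ker, K0.cls_Omega_prod e]
        · simp [AddMonoidHom.mem_ker, K0.cls_Omega_projective P]
      exact fun x hx => h hx)

theorem OmegaBar_cls (M : FGModuleCat.{u} R) : OmegaBar (K0.cls M) = K0.cls (Omega M) := by
  simp [OmegaBar, K0.cls]

/-- `N` is a (nonzero) indecomposable module. -/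
def IsIndecomposableModule (N : FGModuleCat.{u} R) : Prop :=
  Nontrivial N ∧ ∀ X Y : Submodule R N, IsCompl X Y → X = ⊥ ∨ Y = ⊥

/-- `⟨add M⟩`: the subgroup of `K₀` generated by the classes of the indecomposable direct
summands of `M`. -/
def addSpan (M : FGModuleCat.{u} R) : AddSubgroup (K0 R) :=
  AddSubgroup.closure
    {x | ∃ N N' : FGModuleCat.{u} R, IsIndecomposableModule N ∧
      Nonempty (M ≃ₗ[R] N × N') ∧ x = K0.cls N}

/-- The Igusa-Todorov function: `φ(M)` is the least `l` such that `Ω̄` restricted to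
`Ω̄^(l+s) ⟨add M⟩` is a monomorphism for all `s ∈ ℕ`. -/
noncomputable def igusaTodorovPhi (M : FGModuleCat.{u} R) : ℕ∞ :=
  ⨅ l ∈ {l : ℕ | ∀ s : ℕ,
    Set.InjOn (OmegaBar (R := R)) ((OmegaBar (R := R))^[l + s] '' (addSpan M : Set (K0 R)))},
    (l : ℕ∞)

end IgusaTodorov

/-- The `φ`-dimension of a finite-dimensional `K`-algebra `A`: the supremum of `φ(M)` over the
finitely generated right `A`-modules `M`, that is, left modules over `Aᵐᵒᵖ`. -/
noncomputable def phiDim (K : Type uK) (A : Type u) [Field K] [Ring A] [Algebra K A]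
    [Module.Finite K A] : ℕ∞ :=
  haveI : IsArtinianRing Aᵐᵒᵖ :=
    haveI : Module.Finite K Aᵐᵒᵖ := Module.Finite.equiv (MulOpposite.opLinearEquiv K)
    IsArtinianRing.of_finite K Aᵐᵒᵖ
  ⨆ M : FGModuleCat.{u} Aᵐᵒᵖ, igusaTodorovPhi M

/-- `A` is selfinjective: it is injective as a right module over itself. -/
def IsSelfinjective (A : Type u) [Ring A] : Prop :=
  Module.Injective Aᵐᵒᵖ A

/-! # Path algebras and radical square zero algebras -/

section PathAlgebra

/-- All paths of a quiver, including the trivial path at each vertex. -/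
abbrev AllPaths (V : Type v) [Quiver.{w + 1} V] : Type (max v (w + 1)) :=
  Σ a b : V, Quiver.Path a b

variable (K : Type uK) [Field K] (V : Type v) [Quiver.{w + 1} V]

/-- The underlying vector space of the path algebra `KQ`, with basis the paths of `Q`. -/
def PathAlgebra : Type (max uK v (w + 1)) := AllPaths V →₀ K

namespace PathAlgebra

noncomputable instance : AddCommGroup (PathAlgebra K V) :=
  inferInstanceAs (AddCommGroup (AllPaths V →₀ K))

noncomputable instance : Module K (PathAlgebra K V) :=
  inferInstanceAs (Module K (AllPaths V →₀ K))

/-- The basis of `KQ` consisting of the paths. -/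
noncomputable def pathBasis : Module.Basis (AllPaths V) K (PathAlgebra K V) :=
  Module.Basis.ofRepr (LinearEquiv.refl K (AllPaths V →₀ K))

variable {V} in
/-- The basis element of `KQ` given by a path. -/
noncomputable def ofPath {a b : V} (p : Quiver.Path a b) : PathAlgebra K V :=
  pathBasis K V ⟨a, b, p⟩

open Classical in
variable {V} in
/-- The product of two paths: `p` followed by `q` if `q` starts where `p` ends, and `0`
otherwise. -/
noncomputable def mulPath (p q : AllPaths V) : PathAlgebra K V :=
  if h : q.1 = p.2.1 then ofPath K (p.2.2.comp (q.2.2.cast h rfl)) else 0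

/-- The multiplication of `KQ`, extended bilinearly from the product of paths. -/
noncomputable def mulHom : PathAlgebra K V →ₗ[K] PathAlgebra K V →ₗ[K] PathAlgebra K V :=
  (pathBasis K V).constr K fun p => (pathBasis K V).constr K fun q => mulPath K p q

noncomputable instance : Mul (PathAlgebra K V) := ⟨fun x y => mulHom K V x y⟩

variable {K V}

theorem mul_def (x y : PathAlgebra K V) : x * y = mulHom K V x y := rfl

/-- The paths span `KQ`. -/
theorem induction_on {C : PathAlgebra K V → Prop} (x : PathAlgebra K V) (h0 : C 0)
    (hadd : ∀ x y, C x → C y → C (x + y))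
    (hs : ∀ (r : K) (a b : V) (p : Quiver.Path a b), C (r • ofPath K p)) : C x := by
  rw [← (pathBasis K V).linearCombination_repr x]
  generalize (pathBasis K V).repr x = y
  induction y using Finsupp.induction_linear with
  | zero => simpa using h0
  | add f g hf hg => simpa using hadd _ _ hf hg
  | single i r => simpa [ofPath] using hs r i.1 i.2.1 i.2.2

theorem ofPath_mul_ofPath {a b c d : V} (p : Quiver.Path a b) (q : Quiver.Path c d) :
    ofPath K p * ofPath K q = mulPath K ⟨a, b, p⟩ ⟨c, d, q⟩ := by
  simp [mul_def, mulHom, ofPath, Module.Basis.constr_basis]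

theorem ofPath_mul_comp {a b c : V} (p : Quiver.Path a b) (q : Quiver.Path b c) :
    ofPath K p * ofPath K q = ofPath K (p.comp q) := by
  rw [ofPath_mul_ofPath]
  simp [mulPath]

theorem ofPath_mul_of_ne {a b c d : V} (p : Quiver.Path a b) (q : Quiver.Path c d)
    (h : c ≠ b) : ofPath K p * ofPath K q = 0 := by
  rw [ofPath_mul_ofPath]
  simp [mulPath, h]

protected theorem left_distrib (x y z : PathAlgebra K V) : x * (y + z) = x * y + x * z := by
  simp [mul_def]

protected theorem right_distrib (x y z : PathAlgebra K V) : (x + y) * z = x * z + y * z := by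
  simp [mul_def]

protected theorem zero_mul (x : PathAlgebra K V) : 0 * x = 0 := by simp [mul_def]

protected theorem mul_zero (x : PathAlgebra K V) : x * 0 = 0 := by simp [mul_def]

protected theorem smul_mul (r : K) (x y : PathAlgebra K V) : r • x * y = r • (x * y) := by
  simp [mul_def]

protected theorem mul_smul (r : K) (x y : PathAlgebra K V) : x * r • y = r • (x * y) := by
  simp [mul_def]

protected theorem mul_assoc (x y z : PathAlgebra K V) : x * y * z = x * (y * z) := by
  induction x using induction_on with
  | h0 => simp [PathAlgebra.zero_mul]
  | hadd x x' hx hx' => simp [PathAlgebra.right_distrib, hx, hx']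
  | hs r a b p =>
  induction y using induction_on with
  | h0 => simp [PathAlgebra.zero_mul, PathAlgebra.mul_zero]
  | hadd y y' hy hy' => simp [PathAlgebra.right_distrib, PathAlgebra.left_distrib, hy, hy']
  | hs s c d q =>
  induction z using induction_on with
  | h0 => simp [PathAlgebra.mul_zero]
  | hadd z z' hz hz' => simp [PathAlgebra.left_distrib, hz, hz']
  | hs t e f m =>
  simp only [PathAlgebra.smul_mul, PathAlgebra.mul_smul]
  congr 3
  by_cases h1 : c = b
  · subst h1
    by_cases h2 : e = d
    · subst h2
      simp [ofPath_mul_comp]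
    · rw [ofPath_mul_comp, ofPath_mul_of_ne _ _ h2, ofPath_mul_of_ne _ _ h2,
        PathAlgebra.mul_zero]
  · by_cases h2 : e = d
    · subst h2
      rw [ofPath_mul_comp, ofPath_mul_of_ne _ _ h1, ofPath_mul_of_ne _ _ h1,
        PathAlgebra.zero_mul]
    · rw [ofPath_mul_of_ne _ _ h2, ofPath_mul_of_ne _ _ h1, PathAlgebra.zero_mul,
        PathAlgebra.mul_zero]

variable [Fintype V]

noncomputable instance : One (PathAlgebra K V) :=
  ⟨∑ a : V, ofPath K (Quiver.Path.nil : Quiver.Path a a)⟩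

theorem one_def :
    (1 : PathAlgebra K V) = ∑ a : V, ofPath K (Quiver.Path.nil : Quiver.Path a a) := rfl

protected theorem one_mul (x : PathAlgebra K V) : 1 * x = x := by
  induction x using induction_on with
  | h0 => simp [PathAlgebra.mul_zero]
  | hadd x x' hx hx' => simp [PathAlgebra.left_distrib, hx, hx']
  | hs r a b p =>
  rw [PathAlgebra.mul_smul, one_def, mul_def, map_sum, LinearMap.sum_apply]
  simp only [← mul_def]
  rw [Finset.sum_eq_single a]
  · simp [ofPath_mul_comp]
  · intro c _ hc
    exact ofPath_mul_of_ne _ _ hc.symm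
  · simp

protected theorem mul_one (x : PathAlgebra K V) : x * 1 = x := by
  induction x using induction_on with
  | h0 => simp [PathAlgebra.zero_mul]
  | hadd x x' hx hx' => simp [PathAlgebra.right_distrib, hx, hx']
  | hs r a b p =>
  rw [PathAlgebra.smul_mul, one_def, mul_def, map_sum]
  simp only [← mul_def]
  rw [Finset.sum_eq_single b]
  · simp [ofPath_mul_comp]
  · intro c _ hc
    exact ofPath_mul_of_ne _ _ hc
  · simp

noncomputable instance : Ring (PathAlgebra K V) :=
  { (inferInstance : AddCommGroup (PathAlgebra K V)) with
    mul := (· * ·)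
    one := 1
    left_distrib := PathAlgebra.left_distrib
    right_distrib := PathAlgebra.right_distrib
    zero_mul := PathAlgebra.zero_mul
    mul_zero := PathAlgebra.mul_zero
    mul_assoc := PathAlgebra.mul_assoc
    one_mul := PathAlgebra.one_mul
    mul_one := PathAlgebra.mul_one }

noncomputable instance : Algebra K (PathAlgebra K V) :=
  Algebra.ofModule PathAlgebra.smul_mul PathAlgebra.mul_smul

end PathAlgebra

variable [Fintype V]

/-- The two-sided ideal `J` of `KQ` generated by the arrows. -/
noncomputable def arrowIdeal : Ideal (PathAlgebra K V) :=
  (TwoSidedIdeal.span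
    {x | ∃ (a b : V) (α : a ⟶ b), x = PathAlgebra.ofPath K α.toPath}).asIdeal

noncomputable instance : (arrowIdeal K V).IsTwoSided := by
  unfold arrowIdeal
  infer_instance

/-- The radical square zero algebra `KQ / J²`. -/
abbrev RadSqZeroAlgebra : Type (max uK v (w + 1)) := PathAlgebra K V ⧸ (arrowIdeal K V * arrowIdeal K V)

/-- A ring is finitely generated as a right module over itself. -/
theorem finite_mulOpposite_self (A : Type u) [Ring A] : Module.Finite Aᵐᵒᵖ A :=
  Module.Finite.of_surjective (LinearMap.toSpanSingleton Aᵐᵒᵖ A 1)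
    fun x => ⟨MulOpposite.op x, by simp⟩

/-- The semisimple right module `A₀ = KQ / J` over `A = KQ / J²`, realised as the quotient of `A`
by (the right submodule generated by) the image of `J`. -/
noncomputable def semisimpleA0 : FGModuleCat.{max uK v (w + 1)} (RadSqZeroAlgebra K V)ᵐᵒᵖ :=
  haveI := finite_mulOpposite_self (RadSqZeroAlgebra K V)
  FGModuleCat.of (RadSqZeroAlgebra K V)ᵐᵒᵖ
    (RadSqZeroAlgebra K V ⧸ Submodule.span (RadSqZeroAlgebra K V)ᵐᵒᵖ
      (Ideal.Quotient.mk (arrowIdeal K V * arrowIdeal K V) '' (arrowIdeal K V : Set (PathAlgebra K V))))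

variable {V} in
/-- The idempotent `e_a` of `A = KQ / J²` at the vertex `a`. -/
noncomputable def vertexIdempotent (a : V) : RadSqZeroAlgebra K V :=
  Ideal.Quotient.mk (arrowIdeal K V * arrowIdeal K V)
    (PathAlgebra.ofPath K (Quiver.Path.nil : Quiver.Path a a))

variable {K V} in
/-- The support of a right `A`-module `M`, as a set of vertices: those `a` such that the simple
module at `a` is a composition factor of `M`, that is, `M e_a ≠ 0`. -/
def moduleSupport (M : FGModuleCat.{max uK v (w + 1)} (RadSqZeroAlgebra K V)ᵐᵒᵖ) : Set V :=
  {a | ∃ m : M, MulOpposite.op (vertexIdempotent K a) • m ≠ 0}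

/-- The vertices of the heart `C(Q)`: with `n` the number of vertices, those in the support of
`Ω^n(A₀)` and in the support of `Ω^{-n}(A₀)`. -/
def heartVertices : Set V :=
  {a | (∃ N, IsIterSyzygy (Fintype.card V) (semisimpleA0 K V) N ∧ a ∈ moduleSupport N) ∧
    ∃ N, IsIterCosyzygy (Fintype.card V) (semisimpleA0 K V) N ∧ a ∈ moduleSupport N}

/-- The vertices of the member `M(Q)`: those which are not in the heart. -/
def memberVertices : Set V := (heartVertices K V)ᶜ

end PathAlgebra

/-! # Quivers and their adjacency matrices -/

section Quivers

variable (V : Type v) [Quiver.{w + 1} V]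

/-- The quiver is connected (as an undirected graph) and nonempty. -/
def IsConnectedQuiver : Prop :=
  Nonempty V ∧ Subsingleton (Quiver.WeaklyConnectedComponent V)

/-- The quiver is the oriented cycle `Z_n` for some `n ≥ 1`: its vertices are those of `ℤ/n`, with
exactly one arrow from `i` to `i + 1` for each `i`, and no other arrow. -/
def IsCycleQuiver : Prop :=
  ∃ n : ℕ, 1 ≤ n ∧ ∃ f : V ≃ ZMod n,
    ∀ a b : V, Nat.card (a ⟶ b) = if f b = f a + 1 then 1 else 0

/-- The adjacency matrix: its entry at `(a, b)` is the number of arrows from `a` to `b`. -/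
noncomputable def quiverAdjMatrix : Matrix V V ℂ :=
  Matrix.of fun a b => (Nat.card (a ⟶ b) : ℂ)

end Quivers

/-- The algebraic multiplicity of the eigenvalue `0`: its multiplicity as a root of the
characteristic polynomial (it is `0` if `0` is not an eigenvalue). -/
noncomputable def zeroAlgMult {V : Type v} [Fintype V] [DecidableEq V] (M : Matrix V V ℂ) : ℕ :=
  M.charpoly.rootMultiplicity 0

/-- The geometric multiplicity of the eigenvalue `0`: the dimension of its eigenspace. -/
noncomputable def zeroGeomMult {V : Type v} [Fintype V] [DecidableEq V] (M : Matrix V V ℂ) : ℕ :=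
  Module.finrank ℂ (Module.End.eigenspace (Matrix.toLin' M) 0)

set_option linter.unusedSectionVars false

/-! ### Classes in `K₀` and bounds on `φ`. -/

section IgusaTodorovGeneral

variable {R : Type u} [Ring R]

/-! Right `A`-modules are left modules over `R = Aᵐᵒᵖ`, which has a `K`-basis of vertices and arrows
in which two arrows always multiply to zero. The kernel of a projective cover is superfluous, hence
lies in the radical, and arrows kill the radical; so every syzygy is semisimple. Thus `Ω̄` maps `K₀`
into the span of the simples `S_a` (`OmegaBar_mem_range_simpleHom`). As `Ω S_a` is the sum of `S_{t
α}` over the arrows `α` leaving `a`, there `Ω̄` multiplies row vectors by the integral adjacency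
matrix `N` (`OmegaBar_simpleHom`).

If there is no member, every vertex is both a source and a target, because syzygies are supported on
targets and cosyzygies on sources. Sources everywhere make the simples independent in `K₀`
(`simpleHom_injective`). Targets everywhere make every simple a syzygy, namely `S_{t α}` of `R/Rα`,
so a single `M` satisfies `Ω̄⟨add M⟩ ≅ ℤ^V`. Hence `φdim ≤ l + 1` iff `N^(l+1)` and `N^l` have the
same left kernel (`iSup_igusaTodorovPhi_le_succ_iff`). For `l = 0` this says that `0` is not an
eigenvalue, for `l = 1` that `m_a = m_g`; the passage between `ℤ` and `ℂ` is
`hasEigenvalue_zero_iff_int` and `rank_mul_self_eq_iff_int`.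

Dimension zero, selfinjectivity and being a cycle are each equivalent to distinct arrows having
distinct sources. If two arrows leave `a`, then `S_a` and the sum of `R/Rγ` over the arrows `γ`
leaving `a` have the same syzygy but different classes. Conversely, with distinct sources `R` is
selfinjective, every module is projective plus semisimple, and `N` is a permutation matrix; a
connected quiver of this kind is a single cycle. -/

theorem FGModuleCat.length_ne_top [IsArtinianRing R] (M : FGModuleCat.{u} R) :
    Module.length R M ≠ ⊤ := by
  have : IsNoetherian R M := inferInstance
  exact Module.length_ne_top

theorem K0.cls_of_subsingleton (M : FGModuleCat.{u} R) [Subsingleton M] : K0.cls M = 0 := by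
  have : Module.Projective R M := Module.Projective.of_free
  exact K0.cls_projective M

theorem K0.cls_pi {m : ℕ} (X : Fin m → FGModuleCat.{u} R) :
    K0.cls (FGModuleCat.of R (∀ i, X i)) = ∑ i, K0.cls (X i) := by
  induction m with
  | zero =>
    have : Subsingleton (FGModuleCat.of R (∀ i, X i)) :=
      inferInstanceAs (Subsingleton (∀ i, X i))
    simp [K0.cls_of_subsingleton]
  | succ m ih =>
    rw [Fin.sum_univ_succ, ← ih fun i => X i.succ]
    exact K0.cls_of_equiv_prod (M'' := FGModuleCat.of R (∀ i : Fin m, X i.succ))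
      (Fin.consLinearEquiv R fun i => X i).symm

/-- The class of a direct summand of `M` lies in `⟨add M⟩`. -/
theorem cls_mem_addSpan [IsArtinianRing R] {M N N' : FGModuleCat.{u} R} (e : M ≃ₗ[R] N × N') :
    K0.cls N ∈ addSpan M := by
  obtain ⟨n, hn⟩ := ENat.ne_top_iff_exists.1 (FGModuleCat.length_ne_top N)
  induction n using Nat.strong_induction_on generalizing N N' with
  | _ n ih =>
  rcases subsingleton_or_nontrivial N with hN | hN
  · rw [K0.cls_of_subsingleton]
    exact zero_mem _
  by_cases hi : IsIndecomposableModule N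
  · exact AddSubgroup.subset_closure ⟨N, N', hi, ⟨e⟩, rfl⟩
  simp only [IsIndecomposableModule, hN, true_and, not_forall, not_or] at hi
  obtain ⟨X, Y, hXY, hX, hY⟩ := hi
  have hXn : Nontrivial X := Submodule.nontrivial_iff_ne_bot.2 hX
  have hYn : Nontrivial Y := Submodule.nontrivial_iff_ne_bot.2 hY
  have : IsNoetherian R N := inferInstance
  let X' := FGModuleCat.of R X
  let Y' := FGModuleCat.of R Y
  let d : N ≃ₗ[R] X' × Y' := (Submodule.prodEquivOfIsCompl X Y hXY).symm
  have hl : Module.length R N = Module.length R X' + Module.length R Y' := by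
    rw [d.length_eq, Module.length_prod]
  obtain ⟨a, ha⟩ := ENat.ne_top_iff_exists.1 (FGModuleCat.length_ne_top X')
  obtain ⟨b, hb⟩ := ENat.ne_top_iff_exists.1 (FGModuleCat.length_ne_top Y')
  have ha0 : 0 < Module.length R X' := Module.length_pos_iff.2 hXn
  have hb0 : 0 < Module.length R Y' := Module.length_pos_iff.2 hYn
  rw [← ha, ← hb, ← hn] at hl
  rw [← ha] at ha0
  rw [← hb] at hb0
  norm_cast at ha0 hb0 hl
  rw [K0.cls_of_equiv_prod d]
  -- Both pieces of `N` are nonzero, so each is strictly shorter; the other piece joins the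
  -- complement.
  refine add_mem (ih a (by omega) (N' := FGModuleCat.of R (Y' × N')) ?_ ha)
    (ih b (by omega) (N' := FGModuleCat.of R (X' × N')) ?_ hb)
  · exact e.trans ((d.prodCongr (LinearEquiv.refl R N')).trans (LinearEquiv.prodAssoc R X' Y' N'))
  · exact e.trans (((d.trans (LinearEquiv.prodComm R X' Y')).prodCongr
      (LinearEquiv.refl R N')).trans (LinearEquiv.prodAssoc R Y' X' N'))

/-- Finitely many modules are direct summands of a common one. -/
theorem exists_common_summand {ι : Type*} [Finite ι] (X : ι → FGModuleCat.{u} R) :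
    ∃ M : FGModuleCat.{u} R, ∀ i, ∃ N' : FGModuleCat.{u} R, Nonempty (M ≃ₗ[R] X i × N') := by
  classical
  have := Fintype.ofFinite ι
  suffices h : ∀ s : Finset ι, ∃ M : FGModuleCat.{u} R, ∀ i ∈ s,
      ∃ N' : FGModuleCat.{u} R, Nonempty (M ≃ₗ[R] X i × N') by
    obtain ⟨M, hM⟩ := h Finset.univ
    exact ⟨M, fun i => hM i (Finset.mem_univ i)⟩
  intro s
  induction s using Finset.induction_on with
  | empty => exact ⟨FGModuleCat.of R PUnit, by simp⟩
  | insert i s _ ih =>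
    obtain ⟨M, hM⟩ := ih
    refine ⟨FGModuleCat.of R (X i × M), fun j hj => ?_⟩
    rcases Finset.mem_insert.1 hj with rfl | hj
    · exact ⟨M, ⟨LinearEquiv.refl R _⟩⟩
    · obtain ⟨N', ⟨e⟩⟩ := hM j hj
      exact ⟨FGModuleCat.of R (N' × X i), ⟨((LinearEquiv.prodComm R (X i) M).trans
        (e.prodCongr (LinearEquiv.refl R (X i)))).trans (LinearEquiv.prodAssoc R (X j) N' (X i))⟩⟩

variable [IsArtinianRing R]

/-- The admissible `l` form an upward closed set (absorb the difference into `s`), so the infimum is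
at most `l` exactly when `l` is admissible. An empty set gives `⊤`, consistently. -/
theorem igusaTodorovPhi_le_iff (M : FGModuleCat.{u} R) (l : ℕ) :
    igusaTodorovPhi M ≤ l ↔ ∀ s : ℕ, Set.InjOn (OmegaBar (R := R))
      ((OmegaBar (R := R))^[l + s] '' (addSpan M : Set (K0 R))) := by
  refine ⟨fun h => ?_, fun h => iInf₂_le l h⟩
  by_contra hl
  have : ((l + 1 : ℕ) : ℕ∞) ≤ igusaTodorovPhi M := by
    refine le_iInf₂ fun k hk => ?_
    rw [Nat.cast_le]
    by_contra hkl
    refine hl fun s => ?_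
    have := hk (l - k + s)
    rwa [show k + (l - k + s) = l + s by omega] at this
  have := this.trans h
  norm_cast at this
  omega

/-- The class in `K₀` of the kernel of a projective presentation computes `Ω̄`. -/
theorem OmegaBar_cls_of_surjective {M P N : FGModuleCat.{u} R} [Module.Projective R P]
    (p : P →ₗ[R] M) (hp : Function.Surjective p) (f : N ≃ₗ[R] LinearMap.ker p) :
    OmegaBar (K0.cls M) = K0.cls N := by
  obtain ⟨P', p', hp', ⟨f'⟩⟩ := isSyzygy_Omega M
  have := hp'.projective
  rw [OmegaBar_cls]
  exact K0.cls_kernel_eq p' p hp'.surjective hp (LinearEquiv.refl R M) f' f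

end IgusaTodorovGeneral

/-! ### Radical square zero algebras and their modules: radical, socle, simples. -/

/-- A `K`-basis of `R` consisting of orthogonal idempotents `e a`, one for each vertex `a`, and of
elements `ar α`, one for each arrow `α`, which multiply like the vertices and the arrows of a
quiver modulo all paths of length two. Arrows compose like functions: `ar α` maps the vertex
`s α` to the vertex `t α`, that is, `e (t α) * ar α * e (s α) = ar α`. -/
structure RadSqZeroBasis (K : Type uK) {V : Type v} {E : Type w} [Fintype V] [DecidableEq V]
    (s t : E → V) (R : Type u) [Field K] [Ring R] [Algebra K R] where
  basis : Module.Basis (V ⊕ E) K R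
  e_mul_e : ∀ a b, basis (.inl a) * basis (.inl b) = if a = b then basis (.inl a) else 0
  ar_mul_e : ∀ α a, basis (.inr α) * basis (.inl a) = if s α = a then basis (.inr α) else 0
  e_mul_ar : ∀ a α, basis (.inl a) * basis (.inr α) = if t α = a then basis (.inr α) else 0
  ar_mul_ar : ∀ α β, basis (.inr α) * basis (.inr β) = 0
  sum_e : ∑ a, basis (.inl a) = 1

namespace RadSqZeroBasis

variable {K : Type uK} {V : Type v} {E : Type w} [Fintype V] [DecidableEq V]
  {s t : E → V} {R : Type u} [Field K] [Ring R] [Algebra K R] (B : RadSqZeroBasis K s t R)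

noncomputable def e (a : V) : R := B.basis (.inl a)

noncomputable def ar (α : E) : R := B.basis (.inr α)

/-- The coefficient of the idempotent at `a`. -/
noncomputable def chi (a : V) : R →ₗ[K] K := B.basis.coord (.inl a)

@[simp] theorem chi_e (a b : V) : B.chi a (B.e b) = if b = a then 1 else 0 := by
  rw [chi, e, Module.Basis.coord_apply, Module.Basis.repr_self]
  by_cases h : b = a
  · subst h
    simp
  · simp [h]


@[simp] theorem chi_ar (a : V) (α : E) : B.chi a (B.ar α) = 0 := by
  simp [chi, ar]

theorem e_mul (a b : V) : B.e a * B.e b = if a = b then B.e a else 0 := B.e_mul_e a b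

@[simp] theorem e_mul_self (a : V) : B.e a * B.e a = B.e a := by simp [e_mul]

@[simp] theorem ar_mul_source (α : E) : B.ar α * B.e (s α) = B.ar α := by
  exact (B.ar_mul_e α (s α)).trans (if_pos rfl)

theorem ar_ne_zero (α : E) : B.ar α ≠ 0 := B.basis.ne_zero _

/-- Since products of arrows vanish, only the idempotent at the target acts: `K α` is a left ideal
on which `R` acts by the character `chi (t α)`. -/
theorem mul_ar (r : R) (α : E) : r * B.ar α = B.chi (t α) r • B.ar α := by
  have : LinearMap.mulRight K (B.ar α) = (B.chi (t α)).smulRight (B.ar α) := by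
    refine B.basis.ext fun i => ?_
    rcases i with a | β
    · change B.basis (.inl a) * B.basis (.inr α) = B.chi (t α) (B.e a) • B.ar α
      rw [B.e_mul_ar, B.chi_e]
      by_cases h : t α = a
      · simp [h, ar]
      · simp [h, Ne.symm h]
    · change B.basis (.inr β) * B.basis (.inr α) = B.chi (t α) (B.ar β) • B.ar α
      rw [B.ar_mul_ar, B.chi_ar, zero_smul]
  exact LinearMap.congr_fun this r

theorem ar_mul (α : E) (r : R) : B.ar α * r = B.chi (s α) r • B.ar α := by
  have : LinearMap.mulLeft K (B.ar α) = (B.chi (s α)).smulRight (B.ar α) := by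
    refine B.basis.ext fun i => ?_
    rcases i with a | β
    · change B.basis (.inr α) * B.basis (.inl a) = B.chi (s α) (B.e a) • B.ar α
      rw [B.ar_mul_e, B.chi_e]
      by_cases h : s α = a
      · simp [h, ar]
      · simp [h, Ne.symm h]
    · change B.basis (.inr α) * B.basis (.inr β) = B.chi (s α) (B.ar β) • B.ar α
      rw [B.ar_mul_ar, B.chi_ar, zero_smul]
  exact LinearMap.congr_fun this r

-- Together with `chi_one`, this makes `chi a` an algebra character; its kernel `simpleIdeal a`
-- defines the simple module at `a`.
@[simp] theorem chi_mul (a : V) (x y : R) : B.chi a (x * y) = B.chi a x * B.chi a y := by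
  have : (LinearMap.mul K R).compr₂ (B.chi a) =
      (LinearMap.mul K K).compl₁₂ (B.chi a) (B.chi a) := by
    refine B.basis.ext fun i => ?_
    rcases i with b | α
    · refine B.basis.ext fun j => ?_
      rcases j with c | β
      · change B.chi a (B.e b * B.e c) = B.chi a (B.e b) * B.chi a (B.e c)
        rw [e_mul]
        by_cases h : b = c
        · subst h
          by_cases h' : b = a <;> simp [h']
        · by_cases h' : b = a
          · subst h'
            simp [h, Ne.symm h]
          · simp [h, h']
      · change B.chi a (B.e b * B.ar β) = B.chi a (B.e b) * B.chi a (B.ar β)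
        rw [mul_ar, map_smul, chi_ar, smul_zero, mul_zero]
    · refine LinearMap.ext fun y => ?_
      change B.chi a (B.ar α * y) = B.chi a (B.ar α) * B.chi a y
      simp [ar_mul]
  exact LinearMap.congr_fun₂ this x y

@[simp] theorem chi_one (a : V) : B.chi a 1 = 1 := by
  rw [← B.sum_e, map_sum]
  change ∑ b, B.chi a (B.e b) = 1
  simp

@[simp] theorem chi_algebraMap (a : V) (c : K) : B.chi a (algebraMap K R c) = c := by
  simp [Algebra.algebraMap_eq_smul_one]

theorem expansion [Fintype E] (r : R) :
    r = ∑ a, B.chi a r • B.e a + ∑ α, B.basis.coord (.inr α) r • B.ar α := by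
  conv_lhs => rw [← B.basis.sum_repr r, Fintype.sum_sum_type]
  rfl

theorem eq_zero_of_coeff_eq_zero [Fintype E] (r : R) (h : ∀ a, B.chi a r = 0)
    (h' : ∀ α, B.basis.coord (.inr α) r = 0) : r = 0 := by
  rw [B.expansion r]
  simp [h, h']

section Modules

variable (M : Type*) [AddCommGroup M] [Module R M] {N : Type*} [AddCommGroup N] [Module R N]

/-- The radical of a module: the submodule generated by the images of the arrows. -/
def rad : Submodule R M := Submodule.span R {x | ∃ α, ∃ m : M, x = B.ar α • m}

variable {M}

theorem ar_smul_mem_rad (α : E) (m : M) : B.ar α • m ∈ B.rad M :=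
  Submodule.subset_span ⟨α, m, rfl⟩

theorem smul_mem_rad [Fintype E] {r : R} (h : ∀ a, B.chi a r = 0) (m : M) :
    r • m ∈ B.rad M := by
  rw [B.expansion r]
  simp only [h, zero_smul, Finset.sum_const_zero, zero_add, Finset.sum_smul]
  refine sum_mem fun α _ => ?_
  rw [Algebra.smul_def, mul_smul]
  exact Submodule.smul_mem _ _ (B.ar_smul_mem_rad α m)

/-- This is `J² = 0` for modules, and the reason why syzygies are semisimple. -/
theorem ar_smul_of_mem_rad (α : E) {x : M} (hx : x ∈ B.rad M) : B.ar α • x = 0 := by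
  induction hx using Submodule.span_induction with
  | mem x hx =>
    obtain ⟨β, m, rfl⟩ := hx
    have : B.ar α * B.ar β = 0 := B.ar_mul_ar α β
    rw [← mul_smul, this, zero_smul]
  | zero => simp
  | add x y _ _ hx hy => rw [smul_add, hx, hy, add_zero]
  | smul r x _ hx => rw [← mul_smul, ar_mul, Algebra.smul_def, mul_smul, hx, smul_zero]

theorem map_mem_rad (f : M →ₗ[R] N) {x : M} (hx : x ∈ B.rad M) : f x ∈ B.rad N := by
  induction hx using Submodule.span_induction with
  | mem x hx =>
    obtain ⟨β, m, rfl⟩ := hx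
    rw [map_smul]
    exact B.ar_smul_mem_rad β _
  | zero => simp
  | add x y _ _ hx hy => rw [map_add]; exact add_mem hx hy
  | smul r x _ hx => rw [map_smul]; exact Submodule.smul_mem _ _ hx

theorem rad_eq_bot (h : ∀ α (m : M), B.ar α • m = 0) : B.rad M = ⊥ := by
  rw [eq_bot_iff, rad, Submodule.span_le]
  rintro _ ⟨α, m, rfl⟩
  exact h α m

/-- The element `(r - χ_a(r)) e_a` has zero coefficient at every idempotent, so it is a combination
of arrows and kills `m`. -/
theorem smul_e_smul [Fintype E] {m : M} (h : ∀ α, B.ar α • m = 0) (a : V) (r : R) :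
    r • B.e a • m = algebraMap K R (B.chi a r) • B.e a • m := by
  rw [← sub_eq_zero, ← sub_smul, ← mul_smul,
    B.expansion ((r - algebraMap K R (B.chi a r)) * B.e a), add_smul, Finset.sum_smul,
    Finset.sum_smul, Finset.sum_eq_zero, Finset.sum_eq_zero, add_zero]
  · intro α _
    rw [Algebra.smul_def, mul_smul, h, smul_zero]
  · intro b _
    rw [chi_mul, chi_e]
    by_cases hab : a = b
    · subst hab
      simp
    · simp [hab]

variable (M) in
/-- The part at the vertex `a` of the socle of a module. -/
def soc [Fintype E] (a : V) : Submodule R M where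
  carrier := {m | (∀ α, B.ar α • m = 0) ∧ B.e a • m = m}
  zero_mem' := by simp
  add_mem' := by
    rintro x y ⟨hx, hx'⟩ ⟨hy, hy'⟩
    exact ⟨fun α => by rw [smul_add, hx, hy, add_zero], by rw [smul_add, hx', hy']⟩
  smul_mem' := by
    rintro r x ⟨hx, hx'⟩
    refine ⟨fun α => ?_, ?_⟩
    · rw [← mul_smul, ar_mul, Algebra.smul_def, mul_smul, hx, smul_zero]
    · rw [← hx', B.smul_e_smul hx, ← mul_smul, ← Algebra.commutes, mul_smul, ← mul_smul (B.e a),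
        e_mul_self]

theorem mem_soc [Fintype E] {a : V} {m : M} :
    m ∈ B.soc M a ↔ (∀ α, B.ar α • m = 0) ∧ B.e a • m = m := Iff.rfl

theorem e_smul_mem_soc [Fintype E] {m : M} (h : ∀ α, B.ar α • m = 0) (a : V) :
    B.e a • m ∈ B.soc M a := by
  refine ⟨fun α => ?_, ?_⟩
  · rw [← mul_smul, ar_mul, Algebra.smul_def, mul_smul, h, smul_zero]
  · rw [← mul_smul, e_mul_self]

theorem smul_of_mem_soc [Fintype E] {a : V} {m : M} (h : m ∈ B.soc M a) (r : R) :
    r • m = algebraMap K R (B.chi a r) • m := by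
  have := B.smul_e_smul h.1 a r
  rwa [h.2] at this

theorem sum_e_smul (m : M) : ∑ a, B.e a • m = m := by
  rw [← Finset.sum_smul]
  exact (congrArg (· • m) B.sum_e).trans (one_smul R m)

/-- The annihilator of the simple module at `a`. -/
def simpleIdeal (a : V) : Ideal R where
  carrier := {r | B.chi a r = 0}
  zero_mem' := by simp
  add_mem' := by
    intro x y hx hy
    simp only [Set.mem_ofPred_eq] at hx hy ⊢
    rw [map_add, hx, hy, add_zero]
  smul_mem' := by
    intro r x hx
    simp only [Set.mem_ofPred_eq] at hx ⊢
    rw [smul_eq_mul, chi_mul, hx, mul_zero]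

theorem mem_simpleIdeal {a : V} {r : R} : r ∈ B.simpleIdeal a ↔ B.chi a r = 0 := Iff.rfl

theorem _root_.algebraMap_smul_eq_zero_iff_of_ne_zero {c : K} {m : M} (hm : m ≠ 0) :
    algebraMap K R c • m = 0 ↔ c = 0 := by
  refine ⟨fun h => ?_, fun h => by simp [h]⟩
  by_contra hc
  apply hm
  rw [← one_smul R m, ← map_one (algebraMap K R), ← inv_mul_cancel₀ hc, map_mul, mul_smul, h,
    smul_zero]

theorem isCoatom_simpleIdeal (a : V) : IsCoatom (B.simpleIdeal a) := by
  refine ⟨fun h => ?_, fun L hL => ?_⟩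
  · have : (1 : R) ∈ B.simpleIdeal a := h ▸ trivial
    simp [mem_simpleIdeal] at this
  · obtain ⟨r, hr, hr'⟩ := Set.exists_of_ssubset hL
    rw [SetLike.mem_coe, mem_simpleIdeal] at hr'
    rw [Ideal.eq_top_iff_one]
    -- Modulo the ideal, `r` is the scalar `χ_a(r)`, which is invertible.
    have h1 : algebraMap K R (B.chi a r) ∈ L := by
      have : r - (r - algebraMap K R (B.chi a r)) ∈ L :=
        sub_mem hr (hL.le (by simp [mem_simpleIdeal]))
      simpa using this
    have h2 := L.mul_mem_left (algebraMap K R (B.chi a r)⁻¹) h1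
    rwa [← map_mul, inv_mul_cancel₀ hr', map_one] at h2

/-- The simple module at the vertex `a`. -/
noncomputable def simple (a : V) : FGModuleCat.{u} R := FGModuleCat.of R (R ⧸ B.simpleIdeal a)

theorem isSimpleModule_simple (a : V) : IsSimpleModule R (B.simple a) :=
  isSimpleModule_iff_isCoatom.2 (B.isCoatom_simpleIdeal a)

/-- A nonzero element of the socle at `a` generates a simple module. -/
theorem exists_simple_equiv_span [Fintype E] {a : V} {m : M} (h : m ∈ B.soc M a) (hm : m ≠ 0) :
    Nonempty (B.simple a ≃ₗ[R] Submodule.span R {m}) := by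
  have hk : LinearMap.ker (LinearMap.toSpanSingleton R M m) = B.simpleIdeal a := by
    ext r
    rw [LinearMap.mem_ker, LinearMap.toSpanSingleton_apply, B.smul_of_mem_soc h,
      algebraMap_smul_eq_zero_iff_of_ne_zero hm, mem_simpleIdeal]
  exact ⟨(Submodule.quotEquivOfEq _ _ hk.symm).trans
    ((LinearMap.quotKerEquivRange (LinearMap.toSpanSingleton R M m)).trans
      (LinearEquiv.ofEq _ _ (LinearMap.range_toSpanSingleton m)))⟩

theorem ar_smul_simple (α : E) {a : V} (x : B.simple a) : B.ar α • x = 0 := by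
  obtain ⟨r, rfl⟩ := Submodule.Quotient.mk_surjective _ x
  refine (Submodule.Quotient.mk_eq_zero _).2 ?_
  change B.chi a (B.ar α * r) = 0
  simp

theorem soc_simple_self [Fintype E] (a : V) : B.soc (B.simple a) a = ⊤ := by
  rw [eq_top_iff]
  intro x _
  refine ⟨fun α => B.ar_smul_simple α x, ?_⟩
  obtain ⟨r, rfl⟩ := Submodule.Quotient.mk_surjective _ x
  refine (Submodule.Quotient.eq _).2 ?_
  change B.chi a (B.e a * r - r) = 0
  simp

theorem soc_simple_of_ne [Fintype E] {a b : V} (h : a ≠ b) : B.soc (B.simple a) b = ⊥ := by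
  rw [eq_bot_iff]
  rintro x ⟨-, hx⟩
  rw [Submodule.mem_bot, ← hx]
  obtain ⟨r, rfl⟩ := Submodule.Quotient.mk_surjective _ x
  refine (Submodule.Quotient.mk_eq_zero _).2 ?_
  change B.chi a (B.e b * r) = 0
  simp [h.symm]

/-- A module on which the arrows act as zero is semisimple. -/
theorem isSemisimpleModule [Fintype E] (h : ∀ α (m : M), B.ar α • m = 0) :
    IsSemisimpleModule R M := by
  -- The submodules generated by the `e_a m` are zero or simple, and their sum is `M`.
  have hs : ⨆ i : M × V, Submodule.span R {B.e i.2 • i.1} = ⊤ := by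
    rw [eq_top_iff]
    intro m _
    rw [← B.sum_e_smul m]
    exact sum_mem fun a _ => Submodule.mem_iSup_of_mem (m, a) (Submodule.mem_span_singleton_self _)
  refine isSemisimpleModule_of_isSemisimpleModule_submodule' (fun i => ?_) hs
  by_cases hi : B.e i.2 • i.1 = 0
  · have : Subsingleton (Submodule.span R {B.e i.2 • i.1}) := by
      rw [hi, Submodule.span_zero_singleton]
      infer_instance
    exact { exists_isCompl := fun _ =>
      ⟨⊤, IsCompl.of_eq (Subsingleton.elim _ _) (Subsingleton.elim _ _)⟩ }
  · obtain ⟨f⟩ := B.exists_simple_equiv_span (B.e_smul_mem_soc (fun α => h α i.1) i.2) hi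
    have := B.isSimpleModule_simple i.2
    have : IsSimpleModule R (Submodule.span R {B.e i.2 • i.1}) := IsSimpleModule.congr f.symm
    infer_instance

/-- A superfluous submodule is contained in the radical. -/
theorem le_rad_of_superfluous [Fintype E] (L : Submodule R M)
    (hL : ∀ C : Submodule R M, C ⊔ L = ⊤ → C = ⊤) :
    L ≤ B.rad M := by
  have hq : ∀ α (x : M ⧸ B.rad M), B.ar α • x = 0 := by
    intro α x
    obtain ⟨m, rfl⟩ := Submodule.Quotient.mk_surjective _ x
    exact (Submodule.Quotient.mk_eq_zero _).2 (B.ar_smul_mem_rad α m)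
  have := B.isSemisimpleModule hq
  -- A complement `C` of the image of `L` in the semisimple `M / rad M` pulls back to a submodule
  -- that spans `M` together with `L`. So `C` is everything and the image of `L` is zero.
  obtain ⟨C, hC⟩ := exists_isCompl (L.map (B.rad M).mkQ)
  have h1 : C.comap (B.rad M).mkQ = ⊤ := by
    refine hL _ (eq_top_iff.2 fun x _ => ?_)
    have hx : (B.rad M).mkQ x ∈ L.map (B.rad M).mkQ ⊔ C := by rw [hC.sup_eq_top]; trivial
    obtain ⟨_, ⟨l, hl, rfl⟩, c, hc, hlc⟩ := Submodule.mem_sup.1 hx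
    refine Submodule.mem_sup.2 ⟨x - l, ?_, l, hl, by simp⟩
    rw [Submodule.mem_comap, map_sub, ← hlc]
    simpa using hc
  have h2 : C = ⊤ := by
    rw [eq_top_iff]
    intro x _
    obtain ⟨m, rfl⟩ := Submodule.mkQ_surjective _ x
    exact (h1 ▸ Submodule.mem_top : m ∈ C.comap (B.rad M).mkQ)
  have h3 : L.map (B.rad M).mkQ = ⊥ := by
    have := hC.inf_eq_bot
    rwa [h2, inf_top_eq] at this
  intro x hx
  have : (B.rad M).mkQ x ∈ L.map (B.rad M).mkQ := ⟨x, hx, rfl⟩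
  rw [h3, Submodule.mem_bot] at this
  exact (Submodule.Quotient.mk_eq_zero _).1 this

end Modules

end RadSqZeroBasis

/-! ### Counting simple summands; the subgroup of `K₀` spanned by the simples. -/

/-- Meant for `F` the socle at a vertex, or its intersection with the radical: both are compatible
with direct sums, which makes `mult` additive. -/
theorem Module.length_toNat_prod {R M M' M'' : Type*} [Ring R] [IsArtinianRing R]
    [AddCommGroup M] [Module R M]
    [AddCommGroup M'] [Module R M'] [Module.Finite R M'] [AddCommGroup M''] [Module R M'']
    [Module.Finite R M''] (e : M ≃ₗ[R] M' × M'') {F : Submodule R M} {F' : Submodule R M'}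
    {F'' : Submodule R M''} (h : ∀ x, x ∈ F ↔ (e x).1 ∈ F' ∧ (e x).2 ∈ F'') :
    (Module.length R F).toNat = (Module.length R F').toNat + (Module.length R F'').toNat := by
  let f : F ≃ₗ[R] F' × F'' :=
    { toFun := fun x => (⟨(e x).1, ((h x).1 x.2).1⟩, ⟨(e x).2, ((h x).1 x.2).2⟩)
      map_add' := fun x y => by ext <;> simp
      map_smul' := fun r x => by ext <;> simp
      invFun := fun y => ⟨e.symm (y.1, y.2), (h _).2 (by simp)⟩
      left_inv := fun x => by simp
      right_inv := fun y => by simp }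
  have : IsNoetherian R M' := inferInstance
  have : IsNoetherian R M'' := inferInstance
  rw [f.length_eq, Module.length_prod, ENat.toNat_add Module.length_ne_top Module.length_ne_top]

namespace RadSqZeroBasis

variable {K : Type uK} {V : Type v} {E : Type w} [Fintype V] [DecidableEq V]
  {s t : E → V} {R : Type u} [Field K] [Ring R] [Algebra K R] (B : RadSqZeroBasis K s t R)

section

variable {M M' M'' : Type*} [AddCommGroup M] [Module R M] [AddCommGroup M'] [Module R M']
  [AddCommGroup M''] [Module R M'']

theorem mem_rad_iff_of_equiv_prod (e : M ≃ₗ[R] M' × M'') (x : M) :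
    x ∈ B.rad M ↔ (e x).1 ∈ B.rad M' ∧ (e x).2 ∈ B.rad M'' := by
  refine ⟨fun h => ⟨B.map_mem_rad (LinearMap.fst R M' M'' ∘ₗ e.toLinearMap) h,
    B.map_mem_rad (LinearMap.snd R M' M'' ∘ₗ e.toLinearMap) h⟩, fun ⟨h1, h2⟩ => ?_⟩
  have h1' := B.map_mem_rad (e.symm.toLinearMap ∘ₗ LinearMap.inl R M' M'') h1
  have h2' := B.map_mem_rad (e.symm.toLinearMap ∘ₗ LinearMap.inr R M' M'') h2
  have : x = (e.symm.toLinearMap ∘ₗ LinearMap.inl R M' M'') (e x).1 +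
      (e.symm.toLinearMap ∘ₗ LinearMap.inr R M' M'') (e x).2 := by
    simp [← map_add]
  rw [this]
  exact add_mem h1' h2'

theorem mem_soc_iff_of_equiv_prod [Fintype E] (e : M ≃ₗ[R] M' × M'') (a : V) (x : M) :
    x ∈ B.soc M a ↔ (e x).1 ∈ B.soc M' a ∧ (e x).2 ∈ B.soc M'' a := by
  have key : ∀ (r : R) (y : M), r • x = y ↔ r • (e x).1 = (e y).1 ∧ r • (e x).2 = (e y).2 := by
    intro r y
    rw [← e.injective.eq_iff, map_smul, Prod.ext_iff, Prod.smul_fst, Prod.smul_snd]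
  simp only [mem_soc, key, map_zero, Prod.fst_zero, Prod.snd_zero, forall_and]
  tauto

/-- Embed `M` in a free module. A coordinate `r` of a socle element satisfies `0 = α r = χ_{s α}(r)
α` for every arrow `α`; as every vertex is a source, all `χ_c(r)` vanish, so the coordinates lie in
the span of the arrows. Consequently `mult` vanishes on projectives and descends to `K₀`. -/
theorem soc_le_rad_of_projective [Fintype E] (hs : Function.Surjective s)
    [Module.Projective R M] (a : V) : B.soc M a ≤ B.rad M := by
  rintro x ⟨hx, -⟩
  obtain ⟨f, hf⟩ := Module.projective_def'.1 ‹Module.Projective R M›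
  have hfx : Finsupp.linearCombination R id (f x) = x := LinearMap.congr_fun hf x
  rw [← hfx, Finsupp.linearCombination_apply]
  refine sum_mem fun m _ => B.smul_mem_rad (fun c => ?_) m
  obtain ⟨α, rfl⟩ := hs c
  have h1 : B.ar α * f x m = 0 := by
    rw [← smul_eq_mul, ← Finsupp.smul_apply, ← map_smul, hx, map_zero, Finsupp.zero_apply]
  rw [ar_mul] at h1
  exact (smul_eq_zero.1 h1).resolve_right (B.basis.ne_zero _)

end

variable [Fintype E]

/-- The number of direct summands isomorphic to the simple module at `a`, for a module over an
algebra in which this simple module is not projective. -/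
noncomputable def mult (a : V) (M : FGModuleCat.{u} R) : ℤ :=
  (Module.length R (B.soc M a)).toNat - (Module.length R ↥(B.soc M a ⊓ B.rad M)).toNat

theorem mult_of_equiv_prod [IsArtinianRing R] (a : V) {M M' M'' : FGModuleCat.{u} R}
    (e : M ≃ₗ[R] M' × M'') : B.mult a M = B.mult a M' + B.mult a M'' := by
  rw [mult, mult, mult, Module.length_toNat_prod e (B.mem_soc_iff_of_equiv_prod e a),
    Module.length_toNat_prod e (F := B.soc M a ⊓ B.rad M) (F' := B.soc M' a ⊓ B.rad M')
      (F'' := B.soc M'' a ⊓ B.rad M'')]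
  · push_cast
    ring
  · intro x
    rw [Submodule.mem_inf, Submodule.mem_inf, Submodule.mem_inf, B.mem_soc_iff_of_equiv_prod e,
      B.mem_rad_iff_of_equiv_prod e]
    tauto

theorem mult_eq_zero {a : V} {M : FGModuleCat.{u} R} (h : B.soc M a ≤ B.rad M) :
    B.mult a M = 0 := by
  rw [mult, inf_eq_left.2 h, sub_self]

theorem mult_simple (a b : V) : B.mult b (B.simple a) = if a = b then 1 else 0 := by
  rw [mult, B.rad_eq_bot (fun α x => B.ar_smul_simple α x), inf_bot_eq]
  split_ifs with h
  · subst h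
    have := B.isSimpleModule_simple a
    rw [soc_simple_self, Module.length_top, Module.length_eq_one, Module.length_bot]
    simp
  · rw [B.soc_simple_of_ne h, Module.length_bot]
    simp

variable [IsArtinianRing R]

/-- The homomorphism from `K₀` counting the simple direct summands at `a`. -/
noncomputable def multHom (hs : Function.Surjective s) (a : V) : K0 R →+ ℤ :=
  QuotientAddGroup.lift (K0Relations R) (FreeAbelianGroup.lift (B.mult a)) (by
    have h : K0Relations R ≤ (FreeAbelianGroup.lift (B.mult a)).ker := by
      refine (AddSubgroup.closure_le _).2 ?_
      rintro x (⟨M, M', M'', ⟨e⟩, rfl⟩ | ⟨P, hP, rfl⟩)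
      · simp [AddMonoidHom.mem_ker, B.mult_of_equiv_prod a e]
      · simp [AddMonoidHom.mem_ker, B.mult_eq_zero (B.soc_le_rad_of_projective hs a)]
    exact fun x hx => h hx)

theorem multHom_cls (hs : Function.Surjective s) (a : V) (M : FGModuleCat.{u} R) :
    B.multHom hs a (K0.cls M) = B.mult a M := by
  simp [multHom, K0.cls]

/-- The subgroup of `K₀` spanned by the simple modules, parametrized by dimension vectors. -/
noncomputable def simpleHom : (V → ℤ) →+ K0 R where
  toFun c := ∑ a, c a • K0.cls (B.simple a)
  map_zero' := by simp
  map_add' c d := by simp [add_smul, Finset.sum_add_distrib]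

theorem simpleHom_apply (c : V → ℤ) : B.simpleHom c = ∑ a, c a • K0.cls (B.simple a) := rfl

theorem simpleHom_single (a : V) : B.simpleHom (Pi.single a 1) = K0.cls (B.simple a) := by
  rw [simpleHom_apply, Finset.sum_eq_single a] <;> simp +contextual

theorem multHom_simpleHom (hs : Function.Surjective s) (c : V → ℤ) (a : V) :
    B.multHom hs a (B.simpleHom c) = c a := by
  simp [simpleHom_apply, multHom_cls, mult_simple]

/-- The homomorphisms `multHom` recover the coordinates. A vertex that is no source would have a
projective simple module, with class zero. -/
theorem simpleHom_injective (hs : Function.Surjective s) : Function.Injective B.simpleHom := by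
  intro c d h
  funext a
  rw [← B.multHom_simpleHom hs c, h, multHom_simpleHom]

/-- Such a module is semisimple: split off one simple at a time, by induction on length. -/
theorem cls_mem_range_simpleHom {M : FGModuleCat.{u} R} (h : ∀ α (m : M), B.ar α • m = 0) :
    K0.cls M ∈ B.simpleHom.range := by
  obtain ⟨n, hn⟩ := ENat.ne_top_iff_exists.1 (FGModuleCat.length_ne_top M)
  induction n generalizing M with
  | zero =>
    have : Subsingleton M := Module.length_eq_zero_iff.1 (by rw [← hn]; rfl)
    rw [K0.cls_of_subsingleton]
    exact zero_mem _
  | succ n ih =>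
    have : Nontrivial M := Module.length_pos_iff.1 (by rw [← hn]; exact_mod_cast n.succ_pos)
    obtain ⟨m, hm⟩ := exists_ne (0 : M)
    obtain ⟨a, ha⟩ : ∃ a, B.e a • m ≠ 0 := by
      by_contra! h0
      exact hm (by rw [← B.sum_e_smul m]; simp [h0])
    obtain ⟨f⟩ := B.exists_simple_equiv_span (B.e_smul_mem_soc (fun α => h α m) a) ha
    have := B.isSemisimpleModule h
    have : IsNoetherian R M := inferInstance
    obtain ⟨C, hC⟩ := exists_isCompl (Submodule.span R {B.e a • m})
    let C' := FGModuleCat.of R C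
    let d : M ≃ₗ[R] B.simple a × C' := (Submodule.prodEquivOfIsCompl _ _ hC).symm.trans
      (f.symm.prodCongr (LinearEquiv.refl R C))
    rw [K0.cls_of_equiv_prod d]
    refine add_mem ⟨_, B.simpleHom_single a⟩ (ih (M := C') (fun α x => Subtype.ext (h α x.1)) ?_)
    have hl : Module.length R M = 1 + Module.length R C' := by
      have := B.isSimpleModule_simple a
      rw [d.length_eq, Module.length_prod, Module.length_eq_one]
    obtain ⟨k, hk⟩ := ENat.ne_top_iff_exists.1 (FGModuleCat.length_ne_top C')
    rw [← hk, ← hn] at hl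
    rw [← hk]
    norm_cast at hl ⊢
    omega

/-- The kernel of a projective cover is superfluous, so it lies in the radical and is killed by the
arrows. -/
theorem OmegaBar_mem_range_simpleHom (x : K0 R) : OmegaBar x ∈ B.simpleHom.range := by
  obtain ⟨y, rfl⟩ := QuotientAddGroup.mk_surjective x
  induction y using FreeAbelianGroup.induction_on with
  | zero => rw [QuotientAddGroup.mk_zero, map_zero]; exact zero_mem _
  | of M =>
    change OmegaBar (K0.cls M) ∈ _
    rw [OmegaBar_cls]
    obtain ⟨P, p, hp, ⟨f⟩⟩ := isSyzygy_Omega M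
    refine B.cls_mem_range_simpleHom fun α m => f.injective (Subtype.ext ?_)
    rw [map_smul, map_zero]
    exact B.ar_smul_of_mem_rad α (B.le_rad_of_superfluous _ hp.superfluous (f m).2)
  | neg M h => rw [QuotientAddGroup.mk_neg, map_neg]; exact neg_mem h
  | add x y hx hy => rw [QuotientAddGroup.mk_add, map_add]; exact add_mem hx hy

/-! ### Syzygies of the simples and of the quotients by one arrow. -/

/-- The projective module at the vertex `a`. -/
noncomputable def proj (a : V) : FGModuleCat.{u} R := FGModuleCat.of R (Ideal.span {B.e a})

theorem mem_span_e {a : V} {r : R} : r ∈ Ideal.span {B.e a} ↔ r * B.e a = r := by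
  rw [Ideal.mem_span_singleton']
  refine ⟨?_, fun h => ⟨r, h⟩⟩
  rintro ⟨x, rfl⟩
  rw [mul_assoc, e_mul_self]

/-- The retraction of the regular module onto the projective module at `a`. -/
noncomputable def toProj (a : V) : R →ₗ[R] B.proj a :=
  (LinearMap.toSpanSingleton R R (B.e a)).codRestrict (Ideal.span {B.e a})
    fun r => Ideal.mem_span_singleton'.2 ⟨r, rfl⟩

theorem toProj_apply_coe (a : V) (x : B.proj a) : B.toProj a x.1 = x :=
  Subtype.ext (B.mem_span_e.1 x.2)

instance projective_proj (a : V) : Module.Projective R (B.proj a) :=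
  Module.Projective.of_split (Submodule.subtype _) (B.toProj a)
    (LinearMap.ext fun x => B.toProj_apply_coe a x)

/-- The embedding of the simple module at the target of an arrow given by this arrow. -/
noncomputable def arrowMap (α : E) : B.simple (t α) →ₗ[R] R :=
  (B.simpleIdeal (t α)).liftQ (LinearMap.toSpanSingleton R R (B.ar α)) fun r hr => by
    rw [LinearMap.mem_ker, LinearMap.toSpanSingleton_apply, smul_eq_mul, mul_ar,
      B.mem_simpleIdeal.1 hr, zero_smul]

theorem arrowMap_mk (α : E) (r : R) :
    B.arrowMap α (Submodule.Quotient.mk r : R ⧸ B.simpleIdeal (t α)) =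
      B.chi (t α) r • B.ar α :=
  B.mul_ar r α

theorem linearIndependent_ar : LinearIndependent K B.ar :=
  B.basis.linearIndependent.comp Sum.inr Sum.inr_injective

theorem mem_soc_ar (α : E) : B.ar α ∈ B.soc R (t α) := by
  refine ⟨fun β => B.ar_mul_ar β α, ?_⟩
  rw [smul_eq_mul, mul_ar, chi_e, if_pos rfl, one_smul]

/-- The syzygy of a simple module. -/
theorem OmegaBar_cls_simple (a : V) :
    OmegaBar (K0.cls (B.simple a)) = ∑ α with s α = a, K0.cls (B.simple (t α)) := by
  let m := Fintype.card {α // s α = a}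
  let en : Fin m ≃ {α // s α = a} := (Fintype.equivFin _).symm
  let X : Fin m → FGModuleCat.{u} R := fun i => B.simple (t (en i))
  -- The image of `Φ` is the span of the arrows leaving `a`, to be identified with the kernel of `R
  -- e_a → S_a`; the comparison takes place inside `R`.
  let Φ : (∀ i, X i) →ₗ[R] R := ∑ i, B.arrowMap (en i) ∘ₗ LinearMap.proj i
  have hΦ : ∀ r : Fin m → R, Φ (fun i => (Submodule.Quotient.mk (r i) : R ⧸ B.simpleIdeal _)) =
      ∑ i, B.chi (t (en i)) (r i) • B.ar (en i) := by
    intro r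
    exact (LinearMap.sum_apply _ _ _).trans
      (Finset.sum_congr rfl fun i _ => B.arrowMap_mk (en i) (r i))
  have hrep : ∀ x : ∀ i, X i, ∃ r : Fin m → R,
      x = fun i => (Submodule.Quotient.mk (r i) : R ⧸ B.simpleIdeal _) := by
    intro x
    choose r hr using fun i => Submodule.Quotient.mk_surjective _ (x i)
    exact ⟨r, funext fun i => (hr i).symm⟩
  have hinj : Function.Injective Φ := by
    rw [injective_iff_map_eq_zero]
    intro x hx
    obtain ⟨r, rfl⟩ := hrep x
    rw [hΦ] at hx
    have hli : LinearIndependent K fun i => B.ar (en i) :=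
      B.linearIndependent_ar.comp _ (Subtype.val_injective.comp en.injective)
    funext i
    exact (Submodule.Quotient.mk_eq_zero _).2
      (Fintype.linearIndependent_iff.1 hli (fun i => B.chi (t (en i)) (r i)) hx i)
  let p : B.proj a →ₗ[R] B.simple a :=
    (B.simpleIdeal a).mkQ ∘ₗ (Ideal.span {B.e a}).subtype
  have hp : Function.Surjective p := by
    intro x
    obtain ⟨r, rfl⟩ := Submodule.Quotient.mk_surjective _ x
    refine ⟨B.toProj a r, (Submodule.Quotient.eq _).2 ?_⟩
    change B.chi a (r * B.e a - r) = 0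
    simp
  have hpk : ∀ x : B.proj a, p x = 0 ↔ B.chi a x.1 = 0 := fun x =>
    Submodule.Quotient.mk_eq_zero _
  have hrange : (LinearMap.ker p).map (Ideal.span {B.e a}).subtype = LinearMap.range Φ := by
    ext x
    constructor
    · rintro ⟨y, hy, rfl⟩
      have h1 : y.1 * B.e a = y.1 := B.mem_span_e.1 y.2
      have h2 : B.chi a y.1 = 0 := (hpk y).1 hy
      have h3 : ∀ b, B.chi b y.1 = 0 := by
        intro b
        rw [← h1, chi_mul, chi_e]
        split_ifs with hab
        · rw [← hab, h2, zero_mul]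
        · rw [mul_zero]
      -- An element `y = y e_a` with no idempotent part is a combination of arrows leaving `a`; its
      -- preimage under `Φ` is the vector of its coefficients.
      refine ⟨fun i => (Submodule.Quotient.mk
        (algebraMap K R (B.basis.coord (.inr (en i).1) y.1)) : R ⧸ B.simpleIdeal _), ?_⟩
      rw [hΦ]
      simp only [chi_algebraMap]
      rw [en.sum_comp fun α : {α // s α = a} => B.basis.coord (.inr α.1) y.1 • B.ar α.1]
      have h4 := B.expansion y.1
      simp only [h3, zero_smul, Finset.sum_const_zero, zero_add] at h4
      change _ = y.1
      conv_rhs => rw [← h1, h4, Finset.sum_mul]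
      have h5 : ∀ α, B.basis.coord (.inr α) y.1 • B.ar α * B.e a =
          if s α = a then B.basis.coord (.inr α) y.1 • B.ar α else 0 := by
        intro α
        rw [smul_mul_assoc, ar_mul, chi_e]
        by_cases hα : s α = a
        · simp [hα]
        · simp [hα, Ne.symm hα]
      rw [Finset.sum_congr rfl fun α _ => h5 α, ← Finset.sum_filter]
      exact (Finset.sum_subtype _ (by simp) fun α => B.basis.coord (.inr α) y.1 • B.ar α).symm
    · rintro ⟨x, rfl⟩
      obtain ⟨r, rfl⟩ := hrep x
      rw [hΦ]
      refine sum_mem fun i _ => ?_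
      have h1 : B.ar (en i).1 * B.e a = B.ar (en i).1 := by
        rw [ar_mul, chi_e, if_pos (en i).2.symm, one_smul]
      rw [Algebra.smul_def, ← smul_eq_mul]
      refine Submodule.smul_mem _ _ ⟨⟨B.ar (en i).1, B.mem_span_e.2 h1⟩, (hpk _).2 ?_, rfl⟩
      exact B.chi_ar _ _
  have f : FGModuleCat.of R (∀ i, X i) ≃ₗ[R] LinearMap.ker p :=
    (LinearEquiv.ofInjective Φ hinj).trans ((LinearEquiv.ofEq _ _ hrange.symm).trans
      (Submodule.equivMapOfInjective _ (Submodule.subtype_injective _) _).symm)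
  rw [OmegaBar_cls_of_surjective p hp f, K0.cls_pi]
  simp only [X]
  rw [en.sum_comp fun α : {α // s α = a} => K0.cls (B.simple (t α.1))]
  exact (Finset.sum_subtype _ (by simp) fun α => K0.cls (B.simple (t α))).symm

/-- The regular module modulo the submodule generated by an arrow. -/
noncomputable def modArrow (α : E) : FGModuleCat.{u} R :=
  FGModuleCat.of R (R ⧸ Submodule.span R {B.ar α})

/-- The kernel of `R → R/Rα` is `Rα ≅ S_{t α}`. By Schanuel's lemma in `K₀` it does not matter
whether `R` is a projective cover. This realises every simple at a target as a syzygy. -/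
theorem OmegaBar_cls_modArrow (α : E) :
    OmegaBar (K0.cls (B.modArrow α)) = K0.cls (B.simple (t α)) := by
  obtain ⟨f⟩ := B.exists_simple_equiv_span (B.mem_soc_ar α) (B.ar_ne_zero α)
  exact OmegaBar_cls_of_surjective (P := FGModuleCat.of R R) (M := B.modArrow α)
    (Submodule.span R {B.ar α}).mkQ (Submodule.mkQ_surjective _)
    (f.trans (LinearEquiv.ofEq _ _ (Submodule.ker_mkQ _).symm))

/-- If the class of `r` lies in the socle of `R/Rα`, then `γ r ∈ Rα` forces `χ_{s γ}(r) = 0` for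
every arrow `γ ≠ α`. The second arrow `β` covers the vertex `s α` as well, so `r` is a combination
of arrows and its class lies in the radical. -/
theorem mult_modArrow (hs : Function.Surjective s) {α β : E} (hαβ : α ≠ β) (h : s α = s β)
    (b : V) : B.mult b (B.modArrow α) = 0 := by
  refine B.mult_eq_zero ?_
  rintro x ⟨hx, -⟩
  obtain ⟨r, rfl⟩ := Submodule.Quotient.mk_surjective _ x
  have key : ∀ γ, γ ≠ α → B.chi (s γ) r = 0 := by
    intro γ hγ
    have h1 : B.ar γ * r ∈ Submodule.span R {B.ar α} :=
      (Submodule.Quotient.mk_eq_zero _).1 (hx γ)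
    obtain ⟨z, hz⟩ := Submodule.mem_span_singleton.1 h1
    rw [smul_eq_mul, mul_ar, ar_mul] at hz
    have h2 := congrArg (B.basis.coord (.inr γ)) hz
    simpa [ar, hγ, hγ.symm] using h2.symm
  have hr : ∀ c, B.chi c r = 0 := by
    intro c
    obtain ⟨γ, rfl⟩ := hs c
    by_cases hγ : γ = α
    · rw [hγ, h]
      exact key β hαβ.symm
    · exact key γ hγ
  have := B.smul_mem_rad hr (Submodule.Quotient.mk (1 : R) : R ⧸ Submodule.span R {B.ar α})
  rwa [← Submodule.Quotient.mk_smul, smul_eq_mul, mul_one] at this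

end RadSqZeroBasis

/-! ### Selfinjectivity, and the `φ`-dimension in terms of the adjacency matrix. -/

namespace RadSqZeroBasis

variable {K : Type uK} {V : Type v} {E : Type w} [Fintype V] [DecidableEq V]
  {s t : E → V} {R : Type u} [Field K] [Ring R] [Algebra K R] (B : RadSqZeroBasis K s t R)
  [Fintype E]

/-- The integral adjacency matrix of a quiver with source map `s` and target map `t`. -/
def adj (s t : E → V) : Matrix V V ℤ :=
  Matrix.of fun a b => ((Finset.univ.filter fun α => s α = a ∧ t α = b).card : ℤ)

/-- Row `s α` has its only nonzero entry in column `t α`, and that column has no other, so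
multiplication just moves coordinates along arrows. -/
theorem vecMul_adj_apply (hs : Function.Bijective s) (ht : Function.Injective t) (c : V → ℤ)
    (α : E) : (Matrix.vecMul c (adj s t)) (t α) = c (s α) := by
  rw [Matrix.vecMul, dotProduct, Finset.sum_eq_single (s α)]
  · have : (Finset.univ.filter fun γ => s γ = s α ∧ t γ = t α) = {α} := by
      ext γ
      simp only [Finset.mem_filter, Finset.mem_univ, true_and, Finset.mem_singleton]
      exact ⟨fun h => hs.1 h.1, fun h => by simp [h]⟩
    simp [adj, this]
  · intro a _ ha
    have : (Finset.univ.filter fun γ => s γ = a ∧ t γ = t α) = ∅ := by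
      ext γ
      simp only [Finset.mem_filter, Finset.mem_univ, true_and, Finset.notMem_empty, iff_false]
      rintro ⟨h, h'⟩
      exact ha (by rw [← h, ht h'])
    simp [adj, this]
  · simp

theorem eq_zero_of_vecMul_adj (hs : Function.Bijective s) (ht : Function.Injective t)
    (c : V → ℤ) (h : Matrix.vecMul c (adj s t) = 0) : c = 0 := by
  funext a
  obtain ⟨α, rfl⟩ := hs.2 a
  rw [← vecMul_adj_apply hs ht c α, h]
  simp

theorem coord_mul_e (γ : E) (r : R) (a : V) :
    B.basis.coord (.inr γ) (r * B.e a) = if s γ = a then B.basis.coord (.inr γ) r else 0 := by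
  conv_lhs => rw [B.expansion r]
  rw [add_mul, map_add, Finset.sum_mul, Finset.sum_mul, map_sum, map_sum, Finset.sum_eq_zero,
    zero_add, Finset.sum_eq_single γ]
  · rw [smul_mul_assoc, ar_mul, chi_e]
    by_cases hγ : s γ = a
    · simp [hγ, ar]
    · simp [hγ, Ne.symm hγ]
  · intro β _ hβ
    rw [smul_mul_assoc, ar_mul, map_smul, map_smul, ar,
      B.basis.coord_apply (.inr γ) (B.basis (.inr β)), Module.Basis.repr_self,
      Finsupp.single_eq_of_ne (by simpa using hβ.symm), smul_zero, smul_zero]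
  · simp
  · intro b _
    rw [smul_mul_assoc, e_mul]
    split_ifs <;> simp [e]

theorem coord_mul_of_chi_eq_zero (γ : E) (r : R) {x : R} (hx : ∀ a, B.chi a x = 0) :
    B.basis.coord (.inr γ) (r * x) = B.chi (t γ) r * B.basis.coord (.inr γ) x := by
  conv_lhs => rw [B.expansion x]
  simp only [hx, zero_smul, Finset.sum_const_zero, zero_add, Finset.mul_sum, mul_smul_comm,
    mul_ar, map_sum, map_smul]
  rw [Finset.sum_eq_single γ]
  · simp [ar, mul_comm]
  · intro β _ hβ
    simp [ar, hβ]
  · simp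

/-- Over a selfinjective radical square zero algebra different arrows have different sources. -/
theorem source_injective_of_injective (B : RadSqZeroBasis K s t R)
    (h : Module.Injective R R) : Function.Injective s := by
  intro α β hαβ
  by_contra hne
  -- `L` is the span of the arrows and `g` its projection onto `K α`. An extension of `g` to `R` is
  -- right multiplication by `f 1`, which scales an arrow `γ` by `χ_{s γ}(f 1)`. This scalar is `1`
  -- for `α` and `0` for `β`, although their sources agree.
  let L : Ideal R := ⨅ a, B.simpleIdeal a
  have hL : ∀ x : L, ∀ a, B.chi a x.1 = 0 := fun x a => (Submodule.mem_iInf _).1 x.2 a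
  let g : L →ₗ[R] R :=
    { toFun := fun x => B.basis.coord (.inr α) x.1 • B.ar α
      map_add' := fun x y => by
        rw [← add_smul, ← map_add]
        rfl
      map_smul' := fun r x => by
        change B.basis.coord (.inr α) (r * x.1) • _ = r * _
        rw [B.coord_mul_of_chi_eq_zero α r (hL x), mul_smul_comm, mul_ar, smul_smul, mul_comm] }
  obtain ⟨f, hf⟩ := h.out L.subtype (Submodule.subtype_injective L) g
  have hmem : ∀ γ, B.ar γ ∈ L := fun γ =>
    (Submodule.mem_iInf _).2 fun a => B.chi_ar a γ
  have key : ∀ γ, B.chi (s γ) (f 1) • B.ar γ = B.basis.coord (.inr α) (B.ar γ) • B.ar α := by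
    intro γ
    have h1 : f (B.ar γ) = B.basis.coord (.inr α) (B.ar γ) • B.ar α := hf ⟨B.ar γ, hmem γ⟩
    rw [← h1, ← ar_mul, ← smul_eq_mul, ← map_smul, smul_eq_mul, mul_one]
  have h1 := key α
  have h2 := key β
  rw [show B.basis.coord (.inr α) (B.ar α) = 1 by simp [ar]] at h1
  rw [show B.basis.coord (.inr α) (B.ar β) = 0 by simp [ar, Ne.symm hne], zero_smul] at h2
  have h1' := smul_left_injective K (B.ar_ne_zero α) h1
  have h2' := (smul_eq_zero.1 h2).resolve_right (B.ar_ne_zero β)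
  rw [hαβ, h2'] at h1'
  exact zero_ne_one h1'

/-- A radical square zero algebra is selfinjective if every vertex is the source of some arrow and
different arrows have different targets. -/
theorem injective_of_source_target (B : RadSqZeroBasis K s t R)
    (hs : Function.Surjective s) (ht : Function.Injective t) :
    Module.Injective R R := by
  have : Module.Finite K R := Module.Finite.of_basis B.basis
  -- The sum of the arrow coefficients is a Frobenius form: `(y, z) ↦ lam (y * z)` is nondegenerate,
  -- so `z ↦ lam (· * z)` identifies `R` with its `K`-dual.
  let lam : R →ₗ[K] K := ∑ α, B.basis.coord (.inr α)
  let Ψ : R →ₗ[K] R →ₗ[K] K := ((LinearMap.mul K R).compr₂ lam).flip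
  have hΨ : ∀ z y, Ψ z y = lam (y * z) := fun _ _ => rfl
  have lam_ar : ∀ α, lam (B.ar α) = 1 := by
    intro α
    simp only [lam, LinearMap.sum_apply]
    rw [Finset.sum_eq_single α]
    · simp [ar]
    · intro β _ hβ
      simp [ar, hβ.symm]
    · simp
  have nondeg : ∀ z, (∀ y, lam (y * z) = 0) → z = 0 := by
    intro z hz
    have hchi : ∀ a, B.chi a z = 0 := by
      intro a
      obtain ⟨α, rfl⟩ := hs a
      have := hz (B.ar α)
      rwa [ar_mul, map_smul, lam_ar, smul_eq_mul, mul_one] at this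
    refine B.eq_zero_of_coeff_eq_zero z hchi fun α => ?_
    have := hz (B.e (t α))
    simp only [lam, LinearMap.sum_apply] at this
    rw [Finset.sum_eq_single α] at this
    · rwa [B.coord_mul_of_chi_eq_zero _ _ hchi, chi_e, if_pos rfl, one_mul] at this
    · intro β _ hβ
      rw [B.coord_mul_of_chi_eq_zero _ _ hchi, chi_e, if_neg (fun h => hβ (ht h.symm)), zero_mul]
    · simp
  have hinj : Function.Injective Ψ := by
    rw [injective_iff_map_eq_zero]
    intro z hz
    exact nondeg z fun y => by rw [← hΨ, hz, LinearMap.zero_apply]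
  have hsurj : Function.Surjective Ψ :=
    (LinearMap.injective_iff_surjective_of_finrank_eq_finrank
      (Subspace.dual_finrank_eq (K := K) (V := R)).symm).1 hinj
  refine Module.Baer.injective fun I g => ?_
  -- Baer's criterion: extend `lam ∘ g` linearly over `K` and represent the extension by some `c`.
  -- By nondegeneracy `g` is right multiplication by `c`.
  obtain ⟨φ, hφ⟩ := LinearMap.exists_extend (p := I.restrictScalars K)
    (lam ∘ₗ (g.restrictScalars K : I →ₗ[K] R))
  obtain ⟨c, hc⟩ := hsurj φ
  refine ⟨LinearMap.toSpanSingleton R R c, fun x hx => ?_⟩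
  rw [LinearMap.toSpanSingleton_apply, smul_eq_mul, ← sub_eq_zero]
  refine nondeg _ fun y => ?_
  have h1 : φ (y * x) = lam (g ⟨y * x, I.mul_mem_left y hx⟩) :=
    LinearMap.congr_fun hφ ⟨y * x, I.mul_mem_left y hx⟩
  have h2 : g ⟨y * x, I.mul_mem_left y hx⟩ = y * g ⟨x, hx⟩ := g.map_smul y ⟨x, hx⟩
  rw [mul_sub, map_sub, ← h2, ← h1, ← hc, hΨ, mul_assoc, sub_self]

variable [IsArtinianRing R]

/-- Group the summands `S_{t α}` of `Ω S_a` by their target. -/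
theorem OmegaBar_simpleHom (c : V → ℤ) :
    OmegaBar (B.simpleHom c) = B.simpleHom (Matrix.vecMul c (adj s t)) := by
  have h : ∀ a, OmegaBar (K0.cls (B.simple a)) =
      ∑ b, (adj s t a b) • K0.cls (B.simple b) := by
    intro a
    rw [OmegaBar_cls_simple, ← Finset.sum_fiberwise _ t]
    refine Finset.sum_congr rfl fun b _ => ?_
    rw [Finset.filter_filter, Finset.sum_congr rfl (g := fun _ => K0.cls (B.simple b)),
      Finset.sum_const]
    · simp [adj]
    · intro α hα
      rw [(Finset.mem_filter.1 hα).2.2]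
  rw [simpleHom_apply, simpleHom_apply, map_sum]
  simp only [map_zsmul, h, Finset.smul_sum, Matrix.vecMul, dotProduct, Finset.sum_smul, smul_smul]
  rw [Finset.sum_comm]

theorem OmegaBar_iterate_simpleHom (k : ℕ) (c : V → ℤ) :
    (OmegaBar (R := R))^[k] (B.simpleHom c) = B.simpleHom (Matrix.vecMul c (adj s t ^ k)) := by
  induction k with
  | zero => simp
  | succ k ih =>
    rw [Function.iterate_succ_apply', ih, OmegaBar_simpleHom, Matrix.vecMul_vecMul, pow_succ]

/-- The `φ`-dimension is at most `l + 1` if and only if the kernels of the powers `l` and `l + 1`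
of the adjacency matrix agree. -/
theorem iSup_igusaTodorovPhi_le_succ_iff (B : RadSqZeroBasis K s t R)
    (hs : Function.Surjective s) (ht : Function.Surjective t)
    (l : ℕ) : (⨆ M : FGModuleCat.{u} R, igusaTodorovPhi M) ≤ ((l + 1 : ℕ) : ℕ∞) ↔
      ∀ c : V → ℤ, Matrix.vecMul c (adj s t ^ (l + 1)) = 0 →
        Matrix.vecMul c (adj s t ^ l) = 0 := by
  constructor
  · intro h c hc
    -- With every `R/Rα` a summand of `M`, and every vertex a target, each dimension vector `c` has
    -- the form `Ω̄ y` with `y ∈ ⟨add M⟩`. This first application of `Ω̄` accounts for the `+ 1`.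
    obtain ⟨M, hM⟩ := exists_common_summand B.modArrow
    have hMα : ∀ α, K0.cls (B.modArrow α) ∈ addSpan M := by
      intro α
      obtain ⟨N', ⟨f⟩⟩ := hM α
      exact cls_mem_addSpan f
    choose α hα using ht
    let y : K0 R := ∑ a, c a • K0.cls (B.modArrow (α a))
    have hy : y ∈ addSpan M := sum_mem fun a _ => zsmul_mem (hMα _) _
    have hOy : OmegaBar y = B.simpleHom c := by
      rw [simpleHom_apply, map_sum]
      refine Finset.sum_congr rfl fun a _ => ?_
      rw [map_zsmul, OmegaBar_cls_modArrow, hα]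
    have hx : (OmegaBar (R := R))^[l + 1] y = B.simpleHom (Matrix.vecMul c (adj s t ^ l)) := by
      rw [Function.iterate_succ_apply, hOy, OmegaBar_iterate_simpleHom]
    have h1 := (igusaTodorovPhi_le_iff M (l + 1)).1 ((le_iSup _ M).trans h) 0
    have h2 := h1 ⟨y, hy, rfl⟩ ⟨0, zero_mem _, rfl⟩ (by
      rw [add_zero, hx, OmegaBar_simpleHom, Matrix.vecMul_vecMul, ← pow_succ, hc, map_zero,
        iterate_map_zero, map_zero])
    rw [add_zero, hx, iterate_map_zero] at h2
    exact B.simpleHom_injective hs (h2.trans (map_zero _).symm)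
  · intro h
    refine iSup_le fun M => (igusaTodorovPhi_le_iff M (l + 1)).2 fun k => ?_
    rintro _ ⟨x, -, rfl⟩ _ ⟨y, -, rfl⟩ hxy
    -- One `Ω̄` brings the difference into the span of the simples; the hypothesis is then applied
    -- to `c N^k`.
    obtain ⟨c, hc⟩ := B.OmegaBar_mem_range_simpleHom (x - y)
    rw [← sub_eq_zero, ← map_sub, ← iterate_map_sub, show l + 1 + k = (k + l) + 1 by omega,
      Function.iterate_succ_apply, ← hc, OmegaBar_iterate_simpleHom, OmegaBar_simpleHom,
      Matrix.vecMul_vecMul, ← pow_succ, add_assoc, pow_add, ← Matrix.vecMul_vecMul] at hxy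
    have h1 := h _ (B.simpleHom_injective hs (hxy.trans (map_zero _).symm))
    rw [← sub_eq_zero, ← iterate_map_sub, show l + 1 + k = (k + l) + 1 by omega,
      Function.iterate_succ_apply, ← hc, OmegaBar_iterate_simpleHom, pow_add,
      ← Matrix.vecMul_vecMul, h1, map_zero]

/-- If the `φ`-dimension is zero, then different arrows have different sources. -/
theorem source_injective_of_iSup_igusaTodorovPhi (B : RadSqZeroBasis K s t R)
    (hs : Function.Surjective s)
    (h : (⨆ M : FGModuleCat.{u} R, igusaTodorovPhi M) ≤ 0) : Function.Injective s := by
  intro α β hαβ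
  by_contra hne
  obtain ⟨M, hM⟩ := exists_common_summand (Sum.elim B.simple B.modArrow)
  have hMi : ∀ i, K0.cls (Sum.elim B.simple B.modArrow i) ∈ addSpan M := by
    intro i
    obtain ⟨N', ⟨f⟩⟩ := hM i
    exact cls_mem_addSpan f
  have h1 := (igusaTodorovPhi_le_iff M 0).1 ((le_iSup _ M).trans h) 0
  -- `S_a` and the sum of `R/Rγ` over the arrows `γ` leaving `a = s α` have the same image under
  -- `Ω̄`. Counting copies of `S_a` gives `1` on the left; on the right it gives `0`, as each `γ`
  -- shares its source with another arrow.
  have h2 : K0.cls (B.simple (s α)) = ∑ γ with s γ = s α, K0.cls (B.modArrow γ) :=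
    h1 ⟨_, hMi (.inl (s α)), rfl⟩ ⟨_, sum_mem fun γ _ => hMi (.inr γ), rfl⟩ (by
      change OmegaBar (K0.cls (B.simple (s α))) = _
      rw [OmegaBar_cls_simple, map_sum]
      exact Finset.sum_congr rfl fun γ _ => (B.OmegaBar_cls_modArrow γ).symm)
  have h3 := congrArg (B.multHom hs (s α)) h2
  rw [multHom_cls, mult_simple, if_pos rfl, map_sum, Finset.sum_eq_zero] at h3
  · exact one_ne_zero h3
  · intro γ hγ
    rw [multHom_cls]
    have hγ' := (Finset.mem_filter.1 hγ).2
    by_cases hγα : γ = α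
    · rw [hγα]
      exact B.mult_modArrow hs hne hαβ _
    · exact B.mult_modArrow hs hγα hγ' _

/-- Over a selfinjective radical square zero algebra every module is the direct sum of a
projective and a semisimple module. -/
theorem cls_mem_range_simpleHom_of_injective (hR : Module.Injective R R)
    (M : FGModuleCat.{u} R) : K0.cls M ∈ B.simpleHom.range := by
  have hs := B.source_injective_of_injective hR
  obtain ⟨n, hn⟩ := ENat.ne_top_iff_exists.1 (FGModuleCat.length_ne_top M)
  induction n using Nat.strong_induction_on generalizing M with
  | _ n ih =>
  by_cases hM : ∀ α (m : M), B.ar α • m = 0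
  · exact B.cls_mem_range_simpleHom hM
  push Not at hM
  obtain ⟨α, m, hm⟩ := hM
  -- Since `α` is the only arrow leaving `s α`, the module `R e_{s α}` has basis `e_{s α}, α`. As `α
  -- m ≠ 0`, the map `x ↦ x m` is injective on it.
  let f : B.proj (s α) →ₗ[R] M :=
    LinearMap.toSpanSingleton R M m ∘ₗ (Ideal.span {B.e (s α)}).subtype
  have hfx : ∀ x : B.proj (s α), f x = x.1 • m := fun _ => rfl
  have hf : Function.Injective f := by
    rw [injective_iff_map_eq_zero]
    intro x hx
    rw [hfx] at hx
    have hxe : x.1 * B.e (s α) = x.1 := B.mem_span_e.1 x.2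
    have h1 : B.chi (s α) x.1 = 0 := by
      have : (B.ar α * x.1) • m = 0 := by rw [mul_smul, hx, smul_zero]
      rw [ar_mul, Algebra.smul_def, mul_smul] at this
      exact (algebraMap_smul_eq_zero_iff_of_ne_zero hm).1 this
    have h2 : ∀ b, B.chi b x.1 = 0 := by
      intro b
      rw [← hxe, chi_mul, chi_e]
      split_ifs with hb
      · rw [← hb, h1, zero_mul]
      · rw [mul_zero]
    have h3 : ∀ γ, γ ≠ α → B.basis.coord (.inr γ) x.1 = 0 := by
      intro γ hγ
      rw [← hxe, coord_mul_e, if_neg fun h => hγ (hs h)]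
    have h4 : x.1 = B.basis.coord (.inr α) x.1 • B.ar α := by
      conv_lhs => rw [B.expansion x.1]
      simp only [h2, zero_smul, Finset.sum_const_zero, zero_add]
      exact Finset.sum_eq_single α (fun γ _ hγ => by rw [h3 γ hγ, zero_smul]) (by simp)
    rw [h4, Algebra.smul_def, mul_smul] at hx
    have h5 := (algebraMap_smul_eq_zero_iff_of_ne_zero hm).1 hx
    rw [h5, zero_smul] at h4
    exact Subtype.ext h4
  -- Injectivity of `R` extends the inclusion `R e_{s α} → R` along `f`; right multiplication by
  -- `e_{s α}` then gives a retraction, so this projective splits off `M`.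
  obtain ⟨h, hh⟩ := hR.out f hf (Ideal.span {B.e (s α)}).subtype
  let ρ : M →ₗ[R] B.proj (s α) := B.toProj (s α) ∘ₗ h
  have hρ : ∀ x, ρ (f x) = x := by
    intro x
    change B.toProj (s α) (h (f x)) = x
    rw [hh]
    exact B.toProj_apply_coe _ x
  have : IsNoetherian R M := inferInstance
  let N := FGModuleCat.of R (LinearMap.ker ρ)
  let d : M ≃ₗ[R] B.proj (s α) × N :=
    { toFun := fun x => (ρ x, (⟨x - f (ρ x), by simp [hρ]⟩ : LinearMap.ker ρ))
      map_add' := fun x y => Prod.ext (map_add ρ x y) (Subtype.ext (by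
        change x + y - f (ρ (x + y)) = (x - f (ρ x)) + (y - f (ρ y))
        rw [map_add, map_add]
        abel))
      map_smul' := fun r x => Prod.ext (map_smul ρ r x) (Subtype.ext (by
        change r • x - f (ρ (r • x)) = r • (x - f (ρ x))
        rw [map_smul, map_smul, smul_sub]))
      invFun := fun y => f y.1 + (y.2 : LinearMap.ker ρ).1
      left_inv := fun x => by simp
      right_inv := fun y => by
        have hy : ρ (y.2 : LinearMap.ker ρ).1 = 0 := (y.2 : LinearMap.ker ρ).2
        refine Prod.ext ?_ (Subtype.ext ?_)
        · change ρ (f y.1 + (y.2 : LinearMap.ker ρ).1) = y.1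
          rw [map_add, hρ, hy, add_zero]
        · change f y.1 + (y.2 : LinearMap.ker ρ).1 -
            f (ρ (f y.1 + (y.2 : LinearMap.ker ρ).1)) = (y.2 : LinearMap.ker ρ).1
          rw [map_add, hρ, hy, add_zero, add_sub_cancel_left] }
  rw [K0.cls_of_equiv_prod d, K0.cls_projective (B.proj (s α)), zero_add]
  have hl : Module.length R M = Module.length R (B.proj (s α)) + Module.length R N := by
    rw [d.length_eq, Module.length_prod]
  have hpos : 0 < Module.length R (B.proj (s α)) := by
    refine Module.length_pos_iff.2 ⟨⟨⟨B.e (s α), Ideal.mem_span_singleton_self _⟩, 0, fun h0 => ?_⟩⟩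
    exact B.basis.ne_zero (.inl (s α)) (congrArg Subtype.val h0)
  obtain ⟨p, hp⟩ := ENat.ne_top_iff_exists.1 (FGModuleCat.length_ne_top (B.proj (s α)))
  obtain ⟨q, hq⟩ := ENat.ne_top_iff_exists.1 (FGModuleCat.length_ne_top N)
  rw [← hp] at hpos
  rw [← hn, ← hp, ← hq] at hl
  norm_cast at hl hpos
  exact ih q (by omega) N hq

/-- By selfinjectivity the simples span all of `K₀`, and there `Ω̄` acts by an injective matrix. -/
theorem iSup_igusaTodorovPhi_le_zero (B : RadSqZeroBasis K s t R)
    (hs : Function.Bijective s) (ht : Function.Injective t) :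
    (⨆ M : FGModuleCat.{u} R, igusaTodorovPhi M) ≤ 0 := by
  have hR := B.injective_of_source_target hs.2 ht
  have hall : ∀ x : K0 R, x ∈ B.simpleHom.range := by
    intro x
    obtain ⟨y, rfl⟩ := QuotientAddGroup.mk_surjective x
    induction y using FreeAbelianGroup.induction_on with
    | zero => exact zero_mem _
    | of M => exact B.cls_mem_range_simpleHom_of_injective hR M
    | neg M h => rw [QuotientAddGroup.mk_neg]; exact neg_mem h
    | add x y hx hy => rw [QuotientAddGroup.mk_add]; exact add_mem hx hy
  have hinj : Function.Injective (OmegaBar (R := R)) := by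
    rw [injective_iff_map_eq_zero]
    intro x hx
    obtain ⟨c, rfl⟩ := hall x
    rw [OmegaBar_simpleHom] at hx
    rw [eq_zero_of_vecMul_adj hs ht c
      (B.simpleHom_injective hs.2 (hx.trans (map_zero _).symm)), map_zero]
  exact iSup_le fun M => (igusaTodorovPhi_le_iff M 0).2 fun k => hinj.injOn

end RadSqZeroBasis

/-! ### Multiplicities of the eigenvalue zero, and descent from `ℂ` to `ℤ`. -/

section ZeroEigenvalue

variable {V : Type v} [Fintype V] [DecidableEq V] {F : Type*} [Field F]

/-- The kernel of `M` is contained in that of `M²`; by rank-nullity they coincide iff the ranks do.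
-/
theorem Matrix.rank_mul_self_eq_iff (M : Matrix V V F) :
    (M * M).rank = M.rank ↔ ∀ v, Matrix.mulVec M (Matrix.mulVec M v) = 0 → Matrix.mulVec M v = 0 := by
  have h1 := LinearMap.finrank_range_add_finrank_ker M.mulVecLin
  have h2 := LinearMap.finrank_range_add_finrank_ker (M * M).mulVecLin
  have hle : LinearMap.ker M.mulVecLin ≤ LinearMap.ker (M * M).mulVecLin := by
    intro v hv
    rw [LinearMap.mem_ker, Matrix.mulVecLin_apply] at hv ⊢
    rw [← Matrix.mulVec_mulVec, hv, Matrix.mulVec_zero]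
  constructor
  · intro h v hv
    have : LinearMap.ker M.mulVecLin = LinearMap.ker (M * M).mulVecLin :=
      Submodule.eq_of_le_of_finrank_eq hle (by unfold Matrix.rank at h; omega)
    have hv' : v ∈ LinearMap.ker (M * M).mulVecLin := by
      rwa [LinearMap.mem_ker, Matrix.mulVecLin_apply, ← Matrix.mulVec_mulVec]
    rwa [← this, LinearMap.mem_ker, Matrix.mulVecLin_apply] at hv'
  · intro h
    have : LinearMap.ker M.mulVecLin = LinearMap.ker (M * M).mulVecLin := by
      refine le_antisymm hle fun v hv => h v ?_
      rwa [LinearMap.mem_ker, Matrix.mulVecLin_apply, ← Matrix.mulVec_mulVec] at hv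
    rw [← this] at h2
    unfold Matrix.rank
    omega

theorem Matrix.rank_mul_self_eq_iff_vecMul (M : Matrix V V F) :
    (M * M).rank = M.rank ↔
      ∀ v, Matrix.vecMul (Matrix.vecMul v M) M = 0 → Matrix.vecMul v M = 0 := by
  rw [← Matrix.rank_transpose (M * M), ← Matrix.rank_transpose M, Matrix.transpose_mul,
    Matrix.rank_mul_self_eq_iff]
  simp only [Matrix.mulVec_transpose]

/-- Equal ranks mean equal column spaces, so every column of `M` is a combination of columns of
`M²`. An identity of this kind survives extension of the field. -/
theorem Matrix.exists_eq_mul_self_mul {M : Matrix V V F} (h : (M * M).rank = M.rank) :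
    ∃ Y, M = M * M * Y := by
  have hle : LinearMap.range (M * M).mulVecLin ≤ LinearMap.range M.mulVecLin := by
    rintro _ ⟨v, rfl⟩
    exact ⟨Matrix.mulVec M v, by simp⟩
  have heq := Submodule.eq_of_le_of_finrank_eq hle h
  have hcol : ∀ j, ∃ y, Matrix.mulVec (M * M) y = Matrix.mulVec M (Pi.single j 1) := by
    intro j
    have : Matrix.mulVec M (Pi.single j 1) ∈ LinearMap.range (M * M).mulVecLin :=
      heq ▸ ⟨Pi.single j 1, rfl⟩
    exact this
  choose y hy using hcol
  refine ⟨Matrix.of fun i j => y j i, Matrix.ext fun i j => ?_⟩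
  have := congrFun (hy j) i
  rw [Matrix.mulVec_single_one] at this
  exact this.symm

/-- The algebraic multiplicity is the dimension of the generalized eigenspace, which equals the
eigenspace iff `ker M² = ker M`. -/
theorem zeroAlgMult_eq_zeroGeomMult_iff (M : Matrix V V ℂ) :
    zeroAlgMult M = zeroGeomMult M ↔ (M * M).rank = M.rank := by
  have ha : zeroAlgMult M = Module.finrank ℂ (Module.End.maxGenEigenspace (Matrix.toLin' M) 0) := by
    rw [LinearMap.finrank_maxGenEigenspace_eq, Matrix.charpoly_toLin']
    rfl
  have hle : Module.End.eigenspace (Matrix.toLin' M) 0 ≤ Module.End.maxGenEigenspace (Matrix.toLin' M) 0 :=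
    Module.End.genEigenspace_le_maximal _ _ 1
  rw [ha, zeroGeomMult, Matrix.rank_mul_self_eq_iff]
  constructor
  · intro h v hv
    have heq := Submodule.eq_of_le_of_finrank_eq hle h.symm
    have : v ∈ Module.End.maxGenEigenspace (Matrix.toLin' M) 0 := by
      rw [Module.End.mem_maxGenEigenspace]
      refine ⟨2, ?_⟩
      rw [zero_smul, sub_zero, pow_two]
      simpa using hv
    rw [← heq, Module.End.mem_eigenspace_iff, zero_smul] at this
    simpa using this
  · intro h
    have : Module.End.maxGenEigenspace (Matrix.toLin' M) 0 ≤ Module.End.eigenspace (Matrix.toLin' M) 0 := by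
      intro v hv
      obtain ⟨k, hk⟩ := (Module.End.mem_maxGenEigenspace _ _ _).1 hv
      rw [zero_smul, sub_zero] at hk
      rw [Module.End.mem_eigenspace_iff, zero_smul]
      induction k generalizing v with
      | zero =>
        have : v = 0 := by simpa using hk
        rw [this, map_zero]
      | succ k ih =>
        rw [pow_succ, Module.End.mul_apply] at hk
        have h1 := ih ((Module.End.mem_maxGenEigenspace _ _ _).2
          ⟨k, by rwa [zero_smul, sub_zero]⟩) hk
        simpa using h v (by simpa using h1)
    rw [le_antisymm this hle]

theorem exists_int_multiple (v : V → ℚ) :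
    ∃ d : ℤ, d ≠ 0 ∧ ∃ c : V → ℤ, ∀ a, (c a : ℚ) = d * v a := by
  obtain ⟨d, hd⟩ := IsLocalization.exist_integer_multiples_of_finset (nonZeroDivisors ℤ)
    (Finset.univ.image v)
  choose c hc using fun a => hd (v a) (Finset.mem_image_of_mem v (Finset.mem_univ a))
  refine ⟨d, nonZeroDivisors.coe_ne_zero d, c, fun a => ?_⟩
  have := hc a
  rw [zsmul_eq_mul] at this
  simpa using this

theorem vecMul_intCast_map [CharZero F] (N : Matrix V V ℤ) (c : V → ℤ) :
    Matrix.vecMul (fun a => (c a : F)) (N.map (Int.cast : ℤ → F)) =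
      fun a => ((Matrix.vecMul c N a : ℤ) : F) := by
  funext a
  simp [Matrix.vecMul, dotProduct]

theorem intCast_comp_eq_zero [CharZero F] (c : V → ℤ) :
    (fun a => (c a : F)) = 0 ↔ c = 0 := by
  simp [funext_iff]

/-- From `ℂ` to `ℤ`, restrict to integral vectors. Conversely, clearing denominators gives the rank
equality over `ℚ`, and `M = M² Y` carries it to `ℂ`. -/
theorem rank_mul_self_eq_iff_int (N : Matrix V V ℤ) :
    (N.map (Int.cast : ℤ → ℂ) * N.map Int.cast).rank = (N.map (Int.cast : ℤ → ℂ)).rank ↔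
      ∀ c : V → ℤ, Matrix.vecMul (Matrix.vecMul c N) N = 0 → Matrix.vecMul c N = 0 := by
  constructor
  · intro h c hc
    rw [Matrix.rank_mul_self_eq_iff_vecMul] at h
    have := h (fun a => (c a : ℂ))
    rw [vecMul_intCast_map, vecMul_intCast_map, intCast_comp_eq_zero, intCast_comp_eq_zero] at this
    exact this hc
  · intro h
    have hQ : (N.map (Int.cast : ℤ → ℚ) * N.map Int.cast).rank =
        (N.map (Int.cast : ℤ → ℚ)).rank := by
      rw [Matrix.rank_mul_self_eq_iff_vecMul]
      intro v hv
      obtain ⟨d, hd, c, hc⟩ := exists_int_multiple v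
      have hcv : (fun a => (c a : ℚ)) = (d : ℚ) • v := funext hc
      have h1 := h c (by
        rw [← intCast_comp_eq_zero (F := ℚ), ← vecMul_intCast_map, ← vecMul_intCast_map, hcv,
          Matrix.smul_vecMul, Matrix.smul_vecMul, hv, smul_zero])
      rw [← intCast_comp_eq_zero (F := ℚ), ← vecMul_intCast_map, hcv, Matrix.smul_vecMul] at h1
      exact (smul_eq_zero.1 h1).resolve_left (by exact_mod_cast hd)
    obtain ⟨Y, hY⟩ := Matrix.exists_eq_mul_self_mul hQ
    have hmap : (N.map (Int.cast : ℤ → ℚ)).map (Rat.castHom ℂ) = N.map (Int.cast : ℤ → ℂ) := by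
      ext a b
      simp
    have hY' := congrArg (fun X : Matrix V V ℚ => X.map (Rat.castHom ℂ)) hY
    simp only [Matrix.map_mul] at hY'
    rw [hmap] at hY'
    refine le_antisymm (Matrix.rank_mul_le_left _ _) ?_
    conv_lhs => rw [hY']
    exact Matrix.rank_mul_le_left _ _

/-- Both sides say that the determinant vanishes, and a singular integral matrix has a nonzero
integral vector in its left kernel. -/
theorem hasEigenvalue_zero_iff_int (N : Matrix V V ℤ) :
    Module.End.HasEigenvalue (Matrix.toLin' (N.map (Int.cast : ℤ → ℂ))) 0 ↔
      ¬ ∀ c : V → ℤ, Matrix.vecMul c N = 0 → c = 0 := by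
  have h1 : Module.End.HasEigenvalue (Matrix.toLin' (N.map (Int.cast : ℤ → ℂ))) 0 ↔
      (N.map (Int.cast : ℤ → ℂ)).det = 0 := by
    rw [← LinearMap.det_toLin']
    exact (LinearMap.hasEigenvalue_zero_tfae _).out 0 3
  have h2 : (N.map (Int.cast : ℤ → ℂ)).det = 0 ↔ N.det = 0 := by
    rw [← Int.cast_eq_zero (α := ℂ), Int.cast_det]
  rw [h1, h2, ← Matrix.exists_vecMul_eq_zero_iff]
  push Not
  simp only [and_comm]

end ZeroEigenvalue

/-! ### The length filtration of the path algebra. -/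

namespace PathAlgebra

variable {K : Type uK} [Field K] {V : Type v} [Quiver.{w + 1} V]

variable (K V) in
/-- The subspace of the path algebra spanned by the paths of length at least `k`. -/
noncomputable def filtration (k : ℕ) : Submodule K (PathAlgebra K V) :=
  Submodule.span K {x | ∃ (a b : V) (p : Quiver.Path a b), k ≤ p.length ∧ x = ofPath K p}

theorem ofPath_mem_filtration {k : ℕ} {a b : V} (p : Quiver.Path a b) (h : k ≤ p.length) :
    ofPath K p ∈ filtration K V k :=
  Submodule.subset_span ⟨a, b, p, h, rfl⟩

theorem mul_mem_filtration {j k : ℕ} {x y : PathAlgebra K V} (hx : x ∈ filtration K V j)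
    (hy : y ∈ filtration K V k) : x * y ∈ filtration K V (j + k) := by
  induction hx using Submodule.span_induction with
  | mem x hx =>
    obtain ⟨a, b, p, hp, rfl⟩ := hx
    induction hy using Submodule.span_induction with
    | mem y hy =>
      obtain ⟨c, d, q, hq, rfl⟩ := hy
      by_cases h : c = b
      · subst h
        rw [ofPath_mul_comp]
        exact ofPath_mem_filtration _ (by rw [Quiver.Path.length_comp]; omega)
      · rw [ofPath_mul_of_ne p q h]
        exact zero_mem _
    | zero => rw [PathAlgebra.mul_zero]; exact zero_mem _
    | add y z _ _ hy hz => rw [PathAlgebra.left_distrib]; exact add_mem hy hz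
    | smul r y _ hy => rw [PathAlgebra.mul_smul]; exact Submodule.smul_mem _ _ hy
  | zero => rw [PathAlgebra.zero_mul]; exact zero_mem _
  | add x z _ _ hx hz => rw [PathAlgebra.right_distrib]; exact add_mem hx hz
  | smul r x _ hx => rw [PathAlgebra.smul_mul]; exact Submodule.smul_mem _ _ hx

theorem mem_filtration_zero (x : PathAlgebra K V) : x ∈ filtration K V 0 := by
  induction x using induction_on with
  | h0 => exact zero_mem _
  | hadd x y hx hy => exact add_mem hx hy
  | hs r a b p => exact Submodule.smul_mem _ _ (ofPath_mem_filtration p (Nat.zero_le _))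

theorem coord_eq_zero_of_mem_filtration {k : ℕ} {x : PathAlgebra K V}
    (hx : x ∈ filtration K V k) (p : AllPaths V) (hp : p.2.2.length < k) :
    (pathBasis K V).coord p x = 0 := by
  induction hx using Submodule.span_induction with
  | mem x hx =>
    obtain ⟨a, b, q, hq, rfl⟩ := hx
    have hne : (⟨a, b, q⟩ : AllPaths V) ≠ p := by
      rintro rfl
      exact absurd hq (not_le.2 hp)
    rw [ofPath, Module.Basis.coord_apply, Module.Basis.repr_self, Finsupp.single_eq_of_ne hne.symm]
  | zero => exact map_zero _
  | add x y _ _ hx hy => rw [map_add, hx, hy, add_zero]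
  | smul r x _ hx => rw [map_smul, hx, smul_zero]

variable [Fintype V]

theorem arrowIdeal_le_filtration {x : PathAlgebra K V} (hx : x ∈ arrowIdeal K V) :
    x ∈ filtration K V 1 := by
  have hx' : x ∈ TwoSidedIdeal.span
      {x | ∃ (a b : V) (α : a ⟶ b), x = PathAlgebra.ofPath K α.toPath} := hx
  rw [TwoSidedIdeal.mem_span_iff] at hx'
  have h := hx' (TwoSidedIdeal.mk' (filtration K V 1) (zero_mem _) add_mem neg_mem
    (fun {x y} hy => by simpa using mul_mem_filtration (mem_filtration_zero x) hy)
    (fun {x y} hx => by simpa using mul_mem_filtration hx (mem_filtration_zero y))) (by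
      rintro _ ⟨a, b, α, rfl⟩
      rw [SetLike.mem_coe, TwoSidedIdeal.mem_mk']
      exact ofPath_mem_filtration _ (by simp))
  rwa [TwoSidedIdeal.mem_mk'] at h

/-- This keeps the vertices and arrows independent modulo `J²`. -/
theorem arrowIdeal_mul_le_filtration {x : PathAlgebra K V}
    (hx : x ∈ arrowIdeal K V * arrowIdeal K V) : x ∈ filtration K V 2 := by
  rw [show (2 : ℕ) = 1 + 1 from rfl]
  refine Submodule.smul_induction_on hx (fun r hr s hs => ?_) fun x y hx hy => add_mem hx hy
  exact mul_mem_filtration (arrowIdeal_le_filtration hr) (arrowIdeal_le_filtration hs)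

theorem ofPath_mem_arrowIdeal {a b : V} (α : a ⟶ b) : ofPath K α.toPath ∈ arrowIdeal K V :=
  TwoSidedIdeal.subset_span ⟨a, b, α, rfl⟩

end PathAlgebra

/-! ### The basis of `KQ / J²` given by vertices and arrows. -/

section RadSqZeroAlgebra

variable (K : Type uK) [Field K] (V : Type v) [Quiver.{w + 1} V] [Fintype V]

/-- The arrows of a quiver. -/
abbrev Arrows (V : Type v) [Quiver.{w + 1} V] : Type (max v (w + 1)) := Σ a b : V, a ⟶ b

/-- The path of length at most one given by a vertex or an arrow. -/
def shortPath : V ⊕ Arrows V → AllPaths V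
  | .inl a => ⟨a, a, Quiver.Path.nil⟩
  | .inr α => ⟨α.1, α.2.1, α.2.2.toPath⟩

theorem shortPath_injective : Function.Injective (shortPath V) := by
  rintro (a | ⟨a, b, α⟩) (c | ⟨c, d, β⟩) h
  · simp only [shortPath, Sigma.mk.injEq] at h
    rw [h.1]
  · have := congrArg (fun p : AllPaths V => p.2.2.length) h
    simp [shortPath] at this
  · have := congrArg (fun p : AllPaths V => p.2.2.length) h
    simp [shortPath] at this
  · simp only [shortPath, Sigma.mk.injEq] at h
    obtain ⟨rfl, h⟩ := h
    simp only [heq_eq_eq, Sigma.mk.injEq] at h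
    obtain ⟨rfl, h⟩ := h
    simp only [heq_eq_eq] at h
    have := Quiver.Path.cons.inj h
    rw [eq_of_heq this.2.2]

/-- The class in `KQ / J²` of a vertex or an arrow. -/
noncomputable def shortClass (i : V ⊕ Arrows V) : RadSqZeroAlgebra K V :=
  Ideal.Quotient.mkₐ K (arrowIdeal K V * arrowIdeal K V)
    (PathAlgebra.pathBasis K V (shortPath V i))

theorem shortPath_length (i : V ⊕ Arrows V) : (shortPath V i).2.2.length < 2 := by
  rcases i with a | α <;> simp [shortPath]

/-- A relation lifts to an element of `J²`, whose coefficients at paths of length less than two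
vanish. -/
theorem linearIndependent_shortClass : LinearIndependent K (shortClass K V) := by
  rw [linearIndependent_iff']
  intro S c hc i hi
  have h1 : Ideal.Quotient.mkₐ K (arrowIdeal K V * arrowIdeal K V)
      (∑ j ∈ S, c j • PathAlgebra.pathBasis K V (shortPath V j)) = 0 := by
    rw [map_sum, ← hc]
    exact Finset.sum_congr rfl fun j _ => map_smul _ _ _
  have h2 := PathAlgebra.arrowIdeal_mul_le_filtration (Ideal.Quotient.eq_zero_iff_mem.1 h1)
  have h3 := PathAlgebra.coord_eq_zero_of_mem_filtration h2 (shortPath V i) (shortPath_length V i)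
  rw [map_sum, Finset.sum_eq_single i] at h3
  · simpa using h3
  · intro j _ hj
    rw [map_smul, Module.Basis.coord_apply, Module.Basis.repr_self,
      Finsupp.single_eq_of_ne ((shortPath_injective V).ne hj).symm, smul_zero]
  · exact fun h => absurd hi h

theorem span_shortClass : ⊤ ≤ Submodule.span K (Set.range (shortClass K V)) := by
  rintro q -
  obtain ⟨x, rfl⟩ := Ideal.Quotient.mkₐ_surjective K _ q
  induction x using PathAlgebra.induction_on with
  | h0 => rw [map_zero]; exact zero_mem _
  | hadd x y hx hy => rw [map_add]; exact add_mem hx hy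
  | hs r a b p =>
    rw [map_smul]
    refine Submodule.smul_mem _ _ ?_
    rcases p with _ | ⟨p, f⟩
    · exact Submodule.subset_span ⟨.inl a, rfl⟩
    · rcases p with _ | ⟨p, g⟩
      · exact Submodule.subset_span ⟨.inr ⟨a, b, f⟩, rfl⟩
      -- A path of length at least two ends with two arrows, so it lies in `J²`.
      · have h : PathAlgebra.ofPath K ((p.cons g).cons f) ∈
            arrowIdeal K V * arrowIdeal K V := by
          have : PathAlgebra.ofPath K ((p.cons g).cons f) =
              (PathAlgebra.ofPath K p * PathAlgebra.ofPath K g.toPath) *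
                PathAlgebra.ofPath K f.toPath := by
            rw [PathAlgebra.ofPath_mul_comp, PathAlgebra.ofPath_mul_comp]
            rfl
          rw [this]
          exact Ideal.mul_mem_mul (Ideal.mul_mem_left _ _ (PathAlgebra.ofPath_mem_arrowIdeal g))
            (PathAlgebra.ofPath_mem_arrowIdeal f)
        have h0 : Ideal.Quotient.mkₐ K (arrowIdeal K V * arrowIdeal K V)
            (PathAlgebra.ofPath K ((p.cons g).cons f)) = 0 := Ideal.Quotient.eq_zero_iff_mem.2 h
        rw [h0]
        exact zero_mem _

variable [DecidableEq V]

theorem shortClass_mul (i j : V ⊕ Arrows V) : shortClass K V i * shortClass K V j =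
    Ideal.Quotient.mkₐ K (arrowIdeal K V * arrowIdeal K V)
      (PathAlgebra.ofPath K (shortPath V i).2.2 * PathAlgebra.ofPath K (shortPath V j).2.2) :=
  (map_mul _ _ _).symm

/-- The opposite of an algebra isomorphic to `KQ / J²` has a basis consisting of the vertices and
the arrows of `Q`. -/
noncomputable def radSqZeroBasisOfEquiv {A : Type u} [Ring A] [Algebra K A]
    (φ : A ≃ₐ[K] RadSqZeroAlgebra K V) :
    RadSqZeroBasis K (fun α : Arrows V => α.1) (fun α : Arrows V => α.2.1) Aᵐᵒᵖ :=
  let b := (Module.Basis.mk (linearIndependent_shortClass K V) (span_shortClass K V)).map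
    (φ.symm.toLinearEquiv.trans (MulOpposite.opLinearEquiv K))
  have hb : ∀ i, b i = MulOpposite.op (φ.symm (shortClass K V i)) := fun i => by
    simp [b]
  -- Passing to the opposite algebra turns left-to-right concatenation of paths into composition of
  -- functions.
  have hmul : ∀ i j, b i * b j = MulOpposite.op (φ.symm (shortClass K V j * shortClass K V i)) :=
    fun i j => by rw [hb, hb, map_mul, MulOpposite.op_mul]
  { basis := b
    e_mul_e := fun x y => by
      rw [hmul, shortClass_mul]
      by_cases h : x = y
      · subst h
        rw [if_pos rfl, hb]
        simp only [shortPath]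
        rw [PathAlgebra.ofPath_mul_comp]
        rfl
      · simp only [shortPath]
        rw [if_neg h, PathAlgebra.ofPath_mul_of_ne _ _ h, map_zero, map_zero, MulOpposite.op_zero]
    ar_mul_e := fun α x => by
      rw [hmul, shortClass_mul]
      by_cases h : α.1 = x
      · subst h
        rw [if_pos rfl, hb]
        simp only [shortPath]
        rw [PathAlgebra.ofPath_mul_comp, Quiver.Path.nil_comp]
        rfl
      · simp only [shortPath]
        rw [if_neg h, PathAlgebra.ofPath_mul_of_ne _ _ h, map_zero, map_zero, MulOpposite.op_zero]
    e_mul_ar := fun x α => by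
      rw [hmul, shortClass_mul]
      by_cases h : α.2.1 = x
      · subst h
        rw [if_pos rfl, hb]
        simp only [shortPath]
        rw [PathAlgebra.ofPath_mul_comp, Quiver.Path.comp_nil]
        rfl
      · simp only [shortPath]
        rw [if_neg h, PathAlgebra.ofPath_mul_of_ne _ _ (Ne.symm h), map_zero, map_zero,
          MulOpposite.op_zero]
    ar_mul_ar := fun α β => by
      rw [hmul, shortClass_mul]
      have h : Ideal.Quotient.mkₐ K (arrowIdeal K V * arrowIdeal K V)
          (PathAlgebra.ofPath K (shortPath V (.inr β)).2.2 *
            PathAlgebra.ofPath K (shortPath V (.inr α)).2.2) = 0 :=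
        Ideal.Quotient.eq_zero_iff_mem.2 (Ideal.mul_mem_mul
          (PathAlgebra.ofPath_mem_arrowIdeal β.2.2) (PathAlgebra.ofPath_mem_arrowIdeal α.2.2))
      rw [h, map_zero, MulOpposite.op_zero]
    sum_e := by
      simp only [hb]
      rw [← MulOpposite.op_one, ← map_one φ.symm]
      refine (map_sum (MulOpposite.opAddEquiv.toAddMonoidHom.comp
        φ.symm.toLinearEquiv.toLinearMap.toAddMonoidHom) (fun a => shortClass K V (.inl a))
        Finset.univ).symm.trans (congrArg (fun x => MulOpposite.op (φ.symm x)) ?_)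
      exact (map_sum (Ideal.Quotient.mkₐ K (arrowIdeal K V * arrowIdeal K V)) _ _).symm.trans
        (map_one _) }

/-- The heart is defined over `KQ / J²` itself, so supports are read off with the basis for the
identity isomorphism. -/
theorem radSqZeroBasisOfEquiv_refl_e (a : V) :
    (radSqZeroBasisOfEquiv K V AlgEquiv.refl).e a = MulOpposite.op (vertexIdempotent K a) := by
  simp only [RadSqZeroBasis.e, radSqZeroBasisOfEquiv, Module.Basis.map_apply, Module.Basis.mk_apply]
  rfl

end RadSqZeroAlgebra

/-! ### Supports of syzygies and cosyzygies. -/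

namespace RadSqZeroBasis

variable {K : Type uK} {V : Type v} {E : Type w} [Fintype V] [DecidableEq V]
  {s t : E → V} {R : Type u} [Field K] [Ring R] [Algebra K R] (B : RadSqZeroBasis K s t R)
  [Fintype E]

theorem exists_target_of_isSyzygy {M N : FGModuleCat.{u} R} (h : IsSyzygy M N) {a : V} {n : N}
    (hn : B.e a • n ≠ 0) : ∃ α, t α = a := by
  by_contra! ha
  obtain ⟨P, p, hp, ⟨f⟩⟩ := h
  -- The syzygy lies in `rad P`, and `e_a` kills every arrow not ending at `a`. The factor `r` lets
  -- the induction pass through scalar multiples.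
  have key : ∀ x ∈ B.rad P, ∀ r : R, (B.e a * r) • x = 0 := by
    intro x hx
    induction hx using Submodule.span_induction with
    | mem x hx =>
      obtain ⟨α, m, rfl⟩ := hx
      intro r
      rw [← mul_smul, mul_ar, chi_mul, chi_e, if_neg (fun h => ha α h.symm), zero_mul, zero_smul,
        zero_smul]
    | zero => simp
    | add x y _ _ hx hy => intro r; rw [smul_add, hx, hy, add_zero]
    | smul r' x _ hx => intro r; rw [← mul_smul, mul_assoc, hx]
  refine hn (f.injective (Subtype.ext ?_))
  rw [map_smul, map_zero]
  have := key _ (B.le_rad_of_superfluous _ hp.superfluous (f n).2) 1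
  rwa [mul_one] at this

theorem exists_target_of_isIterSyzygy (k : ℕ) {M N : FGModuleCat.{u} R}
    (h : IsIterSyzygy (k + 1) M N) {a : V} {n : N} (hn : B.e a • n ≠ 0) : ∃ α, t α = a := by
  induction k generalizing M with
  | zero =>
    obtain ⟨L, hL, ⟨f⟩⟩ := h
    refine B.exists_target_of_isSyzygy hL (n := f.symm n) fun h0 => hn ?_
    rw [← map_smul] at h0
    exact f.symm.injective (h0.trans (map_zero f.symm).symm)
  | succ k ih =>
    obtain ⟨L, -, hL⟩ := h
    exact ih hL

/-- If no arrow leaves `a`, then each `e_a z` in the injective envelope lies in the socle. When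
nonzero it generates a simple submodule, which meets the essential image of `i` and so lies in it;
hence `e_a` kills the cokernel. -/
theorem exists_source_of_isCosyzygy {M N : FGModuleCat.{u} R} (h : IsCosyzygy M N) {a : V} {n : N}
    (hn : B.e a • n ≠ 0) : ∃ α, s α = a := by
  by_contra! ha
  obtain ⟨I, i, hi, ⟨f⟩⟩ := h
  refine hn (f.injective ?_)
  rw [map_smul, map_zero]
  obtain ⟨z, hz⟩ := Submodule.Quotient.mk_surjective _ (f n)
  rw [← hz, ← Submodule.Quotient.mk_smul, Submodule.Quotient.mk_eq_zero]
  have hy : B.e a • z ∈ B.soc I a := by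
    refine ⟨fun α => ?_, by rw [← mul_smul, e_mul_self]⟩
    rw [← mul_smul, ar_mul, chi_e, if_neg (fun h => ha α h.symm), zero_smul, zero_smul]
  by_contra hr
  have hy0 : B.e a • z ≠ 0 := fun h0 => hr (h0 ▸ zero_mem _)
  have hL : Submodule.span R {B.e a • z} ⊓ LinearMap.range i ≠ ⊥ := fun hb =>
    hy0 (Submodule.span_singleton_eq_bot.1 (hi.essential _ hb))
  obtain ⟨x, hx, hx0⟩ := (Submodule.ne_bot_iff _).1 hL
  obtain ⟨r, rfl⟩ := Submodule.mem_span_singleton.1 hx.1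
  have hx2 := hx.2
  rw [B.smul_of_mem_soc hy] at hx0 hx2
  have hc : B.chi a r ≠ 0 := fun h0 => hx0 (by rw [h0, map_zero, zero_smul])
  have := Submodule.smul_mem _ (algebraMap K R (B.chi a r)⁻¹) hx2
  rw [← mul_smul, ← map_mul, inv_mul_cancel₀ hc, map_one, one_smul] at this
  exact hr this

theorem exists_source_of_isIterCosyzygy (k : ℕ) {M N : FGModuleCat.{u} R}
    (h : IsIterCosyzygy (k + 1) M N) {a : V} {n : N} (hn : B.e a • n ≠ 0) : ∃ α, s α = a := by
  induction k generalizing M with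
  | zero =>
    obtain ⟨L, hL, ⟨f⟩⟩ := h
    refine B.exists_source_of_isCosyzygy hL (n := f.symm n) fun h0 => hn ?_
    rw [← map_smul] at h0
    exact f.symm.injective (h0.trans (map_zero f.symm).symm)
  | succ k ih =>
    obtain ⟨L, -, hL⟩ := h
    exact ih hL

end RadSqZeroBasis

/-! ### Recognising oriented cycles. -/

section CycleQuiver

variable {V : Type v} [Quiver.{w + 1} V]

theorem mem_of_weaklyConnected (hconn : Subsingleton (Quiver.WeaklyConnectedComponent V))
    (S : Set V) (hS : ∀ (a b : V), (a ⟶ b) → (a ∈ S ↔ b ∈ S)) {a : V} (ha : a ∈ S) (b : V) :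
    b ∈ S := by
  obtain ⟨p⟩ := (Quiver.WeaklyConnectedComponent.eq a b).1 (Subsingleton.elim _ _)
  induction p with
  | nil => exact ha
  | cons p f ih =>
    rcases f with f | f
    · exact (hS _ _ f).1 ih
    · exact (hS _ _ f).2 ih

variable [Finite V] [∀ a b : V, Finite (a ⟶ b)]

theorem IsCycleQuiver.source_injective (h : IsCycleQuiver V) :
    Function.Injective fun α : Arrows V => α.1 := by
  obtain ⟨n, -, f, hf⟩ := h
  have key : ∀ a b : V, (a ⟶ b) → f b = f a + 1 := by
    intro a b x
    by_contra hne
    have h0 := hf a b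
    -- `Nat.card` is also `0` on infinite types, which finiteness of the arrow sets excludes.
    rw [if_neg hne, Nat.card_eq_zero] at h0
    rcases h0 with h0 | h0
    · exact h0.elim x
    · exact not_finite (a ⟶ b)
  rintro ⟨a, b, x⟩ ⟨c, d, y⟩ hac
  obtain rfl : a = c := hac
  obtain rfl : b = d := f.injective ((key a b x).trans (key a d y).symm)
  have h1 := hf a b
  rw [if_pos (key a b x)] at h1
  have := (Nat.card_eq_one_iff_unique.1 h1).1
  rw [Subsingleton.elim x y]

/-- Sending the source of each arrow to its target is a permutation `σ`. Connectedness leaves a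
single orbit, which is `ℤ` modulo its period. -/
theorem isCycleQuiver_of_bijective (hconn : IsConnectedQuiver V)
    (hs : Function.Bijective fun α : Arrows V => α.1)
    (ht : Function.Bijective fun α : Arrows V => α.2.1) : IsCycleQuiver V := by
  classical
  let σ : Equiv.Perm V := (Equiv.ofBijective _ hs).symm.trans (Equiv.ofBijective _ ht)
  have hσ : ∀ α : Arrows V, σ α.1 = α.2.1 := by
    intro α
    have h1 : (Equiv.ofBijective _ hs).symm α.1 = α :=
      (Equiv.ofBijective _ hs).symm_apply_apply α
    change (Equiv.ofBijective _ ht) ((Equiv.ofBijective _ hs).symm α.1) = _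
    rw [h1]
    rfl
  have hcard : ∀ a b : V, Nat.card (a ⟶ b) = if b = σ a then 1 else 0 := by
    intro a b
    split_ifs with h
    · rw [Nat.card_eq_one_iff_unique]
      refine ⟨⟨fun x y => ?_⟩, ?_⟩
      · have := hs.1 (a₁ := (⟨a, b, x⟩ : Arrows V)) (a₂ := ⟨a, b, y⟩) rfl
        simpa using this
      · obtain ⟨⟨c, d, x⟩, hc⟩ := hs.2 a
        obtain rfl : c = a := hc
        obtain rfl : b = d := h.trans (hσ ⟨c, d, x⟩)
        exact ⟨x⟩
    · rw [Nat.card_eq_zero]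
      exact Or.inl ⟨fun x => h (hσ ⟨a, b, x⟩).symm⟩
  obtain ⟨⟨v₀⟩, hc⟩ := hconn
  have horb : ∀ v, v ∈ MulAction.orbit (Subgroup.zpowers σ) v₀ := by
    refine mem_of_weaklyConnected hc _ (fun a b x => ?_) (MulAction.mem_orbit_self v₀)
    have hab : b = (⟨σ, Subgroup.mem_zpowers σ⟩ : Subgroup.zpowers σ) • a := (hσ ⟨a, b, x⟩).symm
    rw [hab, ← MulAction.orbit_eq_iff, ← MulAction.orbit_eq_iff, MulAction.orbit_smul]
  let g := MulAction.orbitZPowersEquiv σ v₀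
  let f : V ≃ ZMod (Function.minimalPeriod (σ • ·) v₀) :=
    (Equiv.subtypeUnivEquiv horb).symm.trans g
  have hfs : ∀ k : ℤ, f.symm k = (σ ^ k) v₀ := by
    intro k
    change ((g.symm k : MulAction.orbit (Subgroup.zpowers σ) v₀) : V) = _
    rw [MulAction.orbitZPowersEquiv_symm_apply']
    rfl
  have hfσ : ∀ v, f (σ v) = f v + 1 := by
    intro v
    obtain ⟨k, hk⟩ := ZMod.intCast_surjective (f v)
    have hv : v = (σ ^ k) v₀ := by rw [← hfs, hk, Equiv.symm_apply_apply]
    have hσv : σ v = f.symm ((k + 1 : ℤ) : ZMod _) := by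
      rw [hfs, add_comm, zpow_add, zpow_one, Equiv.Perm.mul_apply, ← hv]
    rw [hσv, Equiv.apply_symm_apply, ← hk]
    push_cast
    rfl
  refine ⟨_, ?_, f, fun a b => ?_⟩
  · rw [Nat.one_le_iff_ne_zero]
    -- Period `0` would identify the finite set `V` with `ZMod 0 = ℤ`.
    intro h0
    have hfin : Finite (ZMod (Function.minimalPeriod (σ • ·) v₀)) := Finite.of_equiv V f
    rw [h0] at hfin
    exact not_finite (ZMod 0)
  · simp only [hcard, ← hfσ, f.injective.eq_iff]

/-- If the source map is bijective, there are as many arrows as vertices, so the surjective target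
map is bijective too. -/
theorem isCycleQuiver_iff (hconn : IsConnectedQuiver V)
    (hs : Function.Surjective fun α : Arrows V => α.1)
    (ht : Function.Surjective fun α : Arrows V => α.2.1) :
    IsCycleQuiver V ↔ Function.Injective fun α : Arrows V => α.1 := by
  refine ⟨fun h => h.source_injective, fun h => ?_⟩
  exact isCycleQuiver_of_bijective hconn ⟨h, hs⟩
    ⟨Function.Surjective.injective_of_finite (Equiv.ofBijective _ ⟨h, hs⟩) ht, ht⟩

end CycleQuiver

theorem quiverAdjMatrix_eq_map_adj (V : Type v) [Quiver.{w + 1} V] [Fintype V] [DecidableEq V]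
    [∀ a b : V, Finite (a ⟶ b)] [Fintype (Arrows V)] :
    quiverAdjMatrix V = (RadSqZeroBasis.adj (fun α : Arrows V => α.1)
      (fun α : Arrows V => α.2.1)).map (Int.cast : ℤ → ℂ) := by
  ext a b
  have e : (a ⟶ b) ≃ {α : Arrows V // α.1 = a ∧ α.2.1 = b} :=
    { toFun := fun x => ⟨⟨a, b, x⟩, rfl, rfl⟩
      invFun := fun α => cast (by obtain ⟨⟨c, d, x⟩, rfl, rfl⟩ := α; rfl) α.1.2.2
      left_inv := fun x => rfl
      right_inv := by
        rintro ⟨⟨c, d, x⟩, rfl, rfl⟩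
        rfl }
  simp [quiverAdjMatrix, RadSqZeroBasis.adj, Nat.card_congr e, Nat.card_eq_fintype_card,
    Fintype.card_subtype]

/-- The map `MulOpposite.op` identifies the right regular module of `A` with the left regular module
of `Aᵐᵒᵖ`. -/
theorem isSelfinjective_iff_mulOpposite (A : Type u) [Ring A] :
    IsSelfinjective A ↔ Module.Injective Aᵐᵒᵖ Aᵐᵒᵖ := by
  let e : A ≃ₗ[Aᵐᵒᵖ] Aᵐᵒᵖ :=
    { MulOpposite.opAddEquiv with
      map_smul' := fun r x => by
        change MulOpposite.op (r • x) = r * MulOpposite.op x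
        rw [← MulOpposite.unop_inj]
        simp }
  rw [IsSelfinjective, ← Module.Baer.iff_injective, ← Module.Baer.iff_injective,
    Module.Baer.congr e]

/-! ### The main theorem. -/

theorem theorem4p38 {K : Type uK} [Field K] {V : Type v} [Quiver.{w + 1} V] [Fintype V]
    [DecidableEq V] [∀ a b : V, Finite (a ⟶ b)] (hconn : IsConnectedQuiver V)
    {A : Type u} [Ring A] [Algebra K A] [Module.Finite K A]
    (hA : Nonempty (A ≃ₐ[K] RadSqZeroAlgebra K V))
    (hmember : memberVertices K V = ∅) :
    (phiDim K A ≤ 2 ↔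
      zeroAlgMult (quiverAdjMatrix V) = zeroGeomMult (quiverAdjMatrix V)) ∧
    (phiDim K A = 0 ↔ IsCycleQuiver V) ∧
    (IsCycleQuiver V ↔ IsSelfinjective A) ∧
    (IsSelfinjective A →
      ¬ Module.End.HasEigenvalue (Matrix.toLin' (quiverAdjMatrix V)) 0) ∧
    (phiDim K A = 1 ↔
      ¬ IsSelfinjective A ∧
        ¬ Module.End.HasEigenvalue (Matrix.toLin' (quiverAdjMatrix V)) 0) ∧
    (zeroAlgMult (quiverAdjMatrix V) = zeroGeomMult (quiverAdjMatrix V) →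
      (phiDim K A = 2 ↔
        Module.End.HasEigenvalue (Matrix.toLin' (quiverAdjMatrix V)) 0)) := by
  classical
  obtain ⟨φ⟩ := hA
  have := Fintype.ofFinite (Arrows V)
  have : Module.Finite K Aᵐᵒᵖ := Module.Finite.equiv (MulOpposite.opLinearEquiv K)
  have : IsArtinianRing Aᵐᵒᵖ := IsArtinianRing.of_finite K Aᵐᵒᵖ
  let B := radSqZeroBasisOfEquiv K V φ
  obtain ⟨hs, ht⟩ : (Function.Surjective fun α : Arrows V => α.1) ∧
      Function.Surjective fun α : Arrows V => α.2.1 := by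
    let B₀ := radSqZeroBasisOfEquiv K V (AlgEquiv.refl (A₁ := RadSqZeroAlgebra K V))
    -- As `Q` is nonempty, `Ω^n` and `Ω^{-n}` involve at least one step; for `n = 0` the supports
    -- would say nothing about arrows.
    have hcard : ∃ k, Fintype.card V = k + 1 := by
      have := hconn.1
      exact Nat.exists_eq_succ_of_ne_zero Fintype.card_ne_zero
    obtain ⟨k, hk⟩ := hcard
    have hheart : ∀ a : V, a ∈ heartVertices K V := by
      intro a
      by_contra ha
      have : a ∈ memberVertices K V := ha
      rw [hmember] at this
      exact this
    refine ⟨fun a => ?_, fun a => ?_⟩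
    · obtain ⟨-, N, hN, n, hn⟩ := hheart a
      rw [hk] at hN
      rw [← radSqZeroBasisOfEquiv_refl_e] at hn
      exact B₀.exists_source_of_isIterCosyzygy k hN hn
    · obtain ⟨⟨N, hN, n, hn⟩, -⟩ := hheart a
      rw [hk] at hN
      rw [← radSqZeroBasisOfEquiv_refl_e] at hn
      exact B₀.exists_target_of_isIterSyzygy k hN hn
  have hinjt : (Function.Injective fun α : Arrows V => α.1) →
      Function.Injective fun α : Arrows V => α.2.1 := fun h =>
    Function.Surjective.injective_of_finite (Equiv.ofBijective _ ⟨h, hs⟩) ht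
  have hcyc := isCycleQuiver_iff hconn hs ht
  have hself : IsSelfinjective A ↔ Function.Injective fun α : Arrows V => α.1 := by
    rw [isSelfinjective_iff_mulOpposite]
    exact ⟨B.source_injective_of_injective, fun h => B.injective_of_source_target hs (hinjt h)⟩
  have hphi0 : phiDim K A = 0 ↔ Function.Injective fun α : Arrows V => α.1 := by
    rw [← nonpos_iff_eq_zero]
    exact ⟨B.source_injective_of_iSup_igusaTodorovPhi hs,
      fun h => B.iSup_igusaTodorovPhi_le_zero ⟨h, hs⟩ (hinjt h)⟩
  -- The criterion with `l = 0`: the left kernel of `N` is zero.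
  have hphi1 : phiDim K A ≤ 1 ↔
      ¬ Module.End.HasEigenvalue (Matrix.toLin' (quiverAdjMatrix V)) 0 := by
    rw [quiverAdjMatrix_eq_map_adj, hasEigenvalue_zero_iff_int, not_not]
    refine (B.iSup_igusaTodorovPhi_le_succ_iff hs ht 0).trans ?_
    simp
  -- The criterion with `l = 1`: the left kernels of `N²` and `N` agree.
  have hphi2 : phiDim K A ≤ 2 ↔
      zeroAlgMult (quiverAdjMatrix V) = zeroGeomMult (quiverAdjMatrix V) := by
    rw [zeroAlgMult_eq_zeroGeomMult_iff, quiverAdjMatrix_eq_map_adj, rank_mul_self_eq_iff_int]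
    refine (B.iSup_igusaTodorovPhi_le_succ_iff hs ht 1).trans ?_
    simp [pow_two]
  refine ⟨hphi2, hphi0.trans hcyc.symm, hcyc.trans hself.symm, fun h => ?_, ?_, fun h => ?_⟩
  · rw [← hphi1, hphi0.2 (hself.1 h)]
    exact zero_le_one
  · rw [hself, ← hphi0, ← hphi1]
    refine ⟨fun h => by simp [h], fun ⟨h0, h1⟩ => le_antisymm h1 (Order.one_le_iff_ne_zero.2 h0)⟩
  · have h2 := hphi2.2 h
    -- Given `φdim ≤ 2`, equality holds iff `φdim ≤ 1` fails.
    rw [← not_not (a := Module.End.HasEigenvalue _ _), ← hphi1, not_le]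
    refine ⟨fun h' => by rw [h']; norm_num, fun h' => le_antisymm h2 ?_⟩
    have := Order.add_one_le_of_lt h'
    rwa [one_add_one_eq_two] at this
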